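/- For a graph $G$ and an integer $k\ge 0$, a $k$-coloring of $G$ is a map $\alpha\colon V(G)\to\{1,\dots,k\}$ with $\alpha(u)\neq\alpha(v)$ for every edge $uv$ of $G$. The $k$-color graph $\mathcal C_k(G)$ has the $k$-colorings of $G$ as its vertices, and two of them are adjacent if and only if they differ on exactly one vertex of $G$. The problem $\ell$-Length $k$-Color Path is the following. Instance: a finite simple graph $G$, nonnegative integers $k$ and $\ell$, and two $k$-colorings $\alpha$ and $\beta$ of $G$. Question: does $\mathcal C_k(G)$ contain a path from $\alpha$ to $\beta$ of length at most $\ell$? The class $W[1]$ consists of all parameterized problems for which there is a constant $d$ such that the problem is fpt-reducible to the following one, with parameter $w$: given a Boolean circuit of depth at most $d$ and weft at most $1$ (every path to the output contains at most one gate of fan-in greater than $2$) and a number $w$, is there a satisfying assignment with exactly $w$ true input variables? Here an fpt-reduction maps an instance $x$ with parameter $p$, in time $f(p)\,|x|^{c}$, to an equivalent instance with parameter at most $g(p)$, where $f,g$ are computable functions and $c$ is a constant. A parameterized problem is $W[1]$-hard if every problem in $W[1]$ is fpt-reducible to it. **Theorem.** The problem $\ell$-Length $k$-Color Path is $W[1]$-hard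 when parameterized by $\ell$ alone; the number $k$ of colors is part of the input. This holds even if $k$ is encoded in unary. -/

import Mathlib

/-! ### Data: finite binary trees -/

/-- Finite binary trees.  They play the role of the words over a finite alphabet:
instances, numerals, lists and circuits are all written as trees. -/
inductive Data : Type
  | nil : Data
  | node : Data → Data → Data
  deriving DecidableEq

namespace Data

/-- The number of nodes of a tree, which is the length of the input it represents. -/
def size : Data → ℕ
  | nil => 1
  | node a b => size a + size b + 1

/-- Left component (`nil` has left component `nil`). -/
def fst : Data → Data
  | nil => nil
  | node a _ => a

/-- Right component (`nil` has right component `nil`). -/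
def snd : Data → Data
  | nil => nil
  | node _ b => b

/-- Compares the two components of a pair: the answer is `node nil nil` (true) or `nil`
(false). -/
def eqTest : Data → Data
  | nil => nil
  | node a b => if a = b then node nil nil else nil

/-- Unary numerals. -/
def ofNat : ℕ → Data
  | 0 => nil
  | n + 1 => node nil (ofNat n)

/-- Truth values. -/
def ofBool : Bool → Data
  | false => nil
  | true => node nil nil

/-- Finite lists. -/
def ofList : List Data → Data
  | [] => nil
  | a :: l => node a (ofList l)

end Data

/-! ### A machine model with a step count -/

/-- While-programs on trees.  Every program maps an input tree to an output tree
(or runs forever). -/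
inductive Prog : Type
  /-- return the input -/
  | id : Prog
  /-- return the empty tree -/
  | nil : Prog
  /-- return the left component of the input -/
  | fst : Prog
  /-- return the right component of the input -/
  | snd : Prog
  /-- compare the two components of the input -/
  | eqTest : Prog
  /-- run `p` and `q` on the input and return the pair of their results -/
  | pair (p q : Prog) : Prog
  /-- run `p`, then run `q` on its result -/
  | seq (p q : Prog) : Prog
  /-- run `p` on the input if the test `c` returns a nonempty tree, and `q` otherwise -/
  | ite (c p q : Prog) : Prog
  /-- as long as the test `c` returns a nonempty tree, replace the current tree by the
  result of `p` on it -/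
  | while (c p : Prog) : Prog

/-- `Prog.Run p x y t`: on input `x` the program `p` halts with output `y` in time `t`.

Every executed instruction is charged `1` plus the size of the tree it is applied to (so no
large datum can be read, copied or compared for free).  In particular the size of every tree
that occurs, the output included, is at most the time used, and the running time agrees up to
a polynomial with that of a multitape Turing machine. -/
inductive Prog.Run : Prog → Data → Data → ℕ → Prop
  | id (x : Data) : Run Prog.id x x (1 + x.size)
  | nil (x : Data) : Run Prog.nil x Data.nil (1 + x.size)
  | fst (x : Data) : Run Prog.fst x x.fst (1 + x.size)
  | snd (x : Data) : Run Prog.snd x x.snd (1 + x.size)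
  | eqTest (x : Data) : Run Prog.eqTest x x.eqTest (1 + x.size)
  | pair {p q : Prog} {x y z : Data} {s t : ℕ} (hp : Run p x y s) (hq : Run q x z t) :
      Run (Prog.pair p q) x (Data.node y z) (s + t + (1 + x.size))
  | seq {p q : Prog} {x y z : Data} {s t : ℕ} (hp : Run p x y s) (hq : Run q y z t) :
      Run (Prog.seq p q) x z (s + t + (1 + x.size))
  | ite_true {c p q : Prog} {x b y : Data} {s t : ℕ} (hc : Run c x b s) (hb : b ≠ Data.nil)
      (hp : Run p x y t) : Run (Prog.ite c p q) x y (s + t + (1 + x.size))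
  | ite_false {c p q : Prog} {x y : Data} {s t : ℕ} (hc : Run c x Data.nil s)
      (hq : Run q x y t) : Run (Prog.ite c p q) x y (s + t + (1 + x.size))
  | while_stop {c p : Prog} {x : Data} {s : ℕ} (hc : Run c x Data.nil s) :
      Run (Prog.while c p) x x (s + (1 + x.size))
  | while_step {c p : Prog} {x b y z : Data} {s t u : ℕ} (hc : Run c x b s)
      (hb : b ≠ Data.nil) (hp : Run p x y t) (hw : Run (Prog.while c p) y z u) :
      Run (Prog.while c p) x z (s + t + u + (1 + x.size))

/-! ### Parameterized problems and fpt-reductions -/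

/-- A parameterized problem: a set of pairs (instance, parameter). -/
abbrev ParamProblem : Type := Set (Data × ℕ)

/-- `FptReduces P Q`: there is an fpt-reduction from `P` to `Q`, that is, a program that maps
every pair `(x, k)` to a pair `(y, m)` with `(x, k) ∈ P ↔ (y, m) ∈ Q`, in time at most
`f k * |x| ^ c` and with `m ≤ g k`, for computable functions `f`, `g` and a constant `c`. -/
def FptReduces (P Q : ParamProblem) : Prop :=
  ∃ (R : Prog) (f g : ℕ → ℕ) (c : ℕ), Computable f ∧ Computable g ∧
    ∀ (x : Data) (k : ℕ), ∃ (y : Data) (m t : ℕ),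
      R.Run (Data.node x (Data.ofNat k)) (Data.node y (Data.ofNat m)) t ∧
      t ≤ f k * x.size ^ c ∧
      m ≤ g k ∧
      ((x, k) ∈ P ↔ (y, m) ∈ Q)

/-! ### Boolean circuits, weft, and the classes `W[t]` -/

/-- The gates of a circuit.  A gate refers to other gates by their positions; the conjunction
and disjunction gates have arbitrary fan-in. -/
inductive Gate : Type
  | input (i : ℕ) : Gate
  | neg (j : ℕ) : Gate
  | conj (l : List ℕ) : Gate
  | disj (l : List ℕ) : Gate

namespace Gate

/-- The positions of the gates that are wired into a gate. -/
def preds : Gate → List ℕ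
  | input _ => []
  | neg j => [j]
  | conj l => l
  | disj l => l

/-- The value of a gate, given the set `S` of the input variables that are true and the list
of the values of all earlier gates. -/
def value (S : Finset ℕ) (vals : List Bool) : Gate → Bool
  | input i => decide (i ∈ S)
  | neg j => !(vals.getD j false)
  | conj l => l.all fun j => vals.getD j false
  | disj l => l.any fun j => vals.getD j false

/-- The length of a longest path that ends in a gate, given these lengths for all earlier
gates. -/
def depth (ds : List ℕ) : Gate → ℕ
  | input _ => 0
  | neg j => 1 + ds.getD j 0
  | conj l => 1 + (l.map fun j => ds.getD j 0).foldr max 0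
  | disj l => 1 + (l.map fun j => ds.getD j 0).foldr max 0

/-- The maximum number of large gates (gates of fan-in more than two) on a path that ends in a
gate, given these numbers for all earlier gates. -/
def weft (ws : List ℕ) (g : Gate) : ℕ :=
  (if 2 < g.preds.length then 1 else 0) + (g.preds.map fun j => ws.getD j 0).foldr max 0

/-- A gate, written as a tree. -/
def encode : Gate → Data
  | input i => Data.node (Data.ofNat 0) (Data.ofNat i)
  | neg j => Data.node (Data.ofNat 1) (Data.ofNat j)
  | conj l => Data.node (Data.ofNat 2) (Data.ofList (l.map Data.ofNat))
  | disj l => Data.node (Data.ofNat 3) (Data.ofList (l.map Data.ofNat))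

end Gate

/-- A Boolean circuit (with one output, the last gate): the number of its input variables, and
its gates in topological order. -/
structure Circuit : Type where
  numInputs : ℕ
  gates : List Gate

namespace Circuit

/-- There is an output gate, wires come from earlier gates, and the input gates read existing
variables. -/
def WellFormed (C : Circuit) : Prop :=
  C.gates ≠ [] ∧
  ∀ (i : ℕ) (h : i < C.gates.length),
    (∀ j ∈ (C.gates[i]).preds, j < i) ∧ ∀ v, C.gates[i] = Gate.input v → v < C.numInputs

/-- Computes a quantity for all gates, from the first to the last; `step` gets the list of the
values for the earlier gates. -/
def sweep {β : Type} (C : Circuit) (step : List β → Gate → β) : List β :=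
  C.gates.foldl (fun acc g => acc ++ [step acc g]) []

/-- The output of the circuit when exactly the variables in `S` are true. -/
def eval (C : Circuit) (S : Finset ℕ) : Bool :=
  (C.sweep (Gate.value S)).getLastD false

/-- The length of a longest path to the output gate. -/
def depth (C : Circuit) : ℕ :=
  (C.sweep Gate.depth).getLastD 0

/-- The maximum number of large gates on a path to the output gate. -/
def weft (C : Circuit) : ℕ :=
  (C.sweep Gate.weft).getLastD 0

/-- A circuit, written as a tree. -/
def encode (C : Circuit) : Data :=
  Data.node (Data.ofNat C.numInputs) (Data.ofList (C.gates.map Gate.encode))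

end Circuit

/-- Weighted circuit satisfiability for circuits of weft at most `t` and depth at most `d`:
given a circuit and the parameter `k`, is there a satisfying assignment in which exactly `k`
of the input variables are true? -/
def WeightedCircuitSat (t d : ℕ) : ParamProblem :=
  {p | ∃ C : Circuit, C.WellFormed ∧ C.weft ≤ t ∧ C.depth ≤ d ∧ p.1 = C.encode ∧
    ∃ S : Finset ℕ, S ⊆ Finset.range C.numInputs ∧ S.card = p.2 ∧ C.eval S = true}

/-- The class `W[t]`: the parameterized problems that are fpt-reducible, for some constant `d`,
to weighted satisfiability of circuits of weft at most `t` and depth at most `d`. -/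
def WClass (t : ℕ) : Set ParamProblem :=
  {Q | ∃ d : ℕ, FptReduces Q (WeightedCircuitSat t d)}

/-- A parameterized problem is `W[t]`-hard if every problem in `W[t]` is fpt-reducible to it. -/
def WHard (t : ℕ) (P : ParamProblem) : Prop :=
  ∀ Q ∈ WClass t, FptReduces Q P

/-! ### The `k`-color graph and the problem `ℓ`-Length `k`-Color Path -/

/-- The `k`-color graph of `G`: its vertices are the `k`-colorings of `G`, and two of them are
adjacent iff they differ on exactly one vertex of `G`. -/
def colorGraph {V : Type} (G : SimpleGraph V) (k : ℕ) : SimpleGraph (G.Coloring (Fin k)) where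
  Adj α β := ∃! v, α v ≠ β v
  symm := ⟨fun _ _ ⟨v, hv, hu⟩ => ⟨v, Ne.symm hv, fun w hw => hu w (Ne.symm hw)⟩⟩
  loopless := ⟨fun _ ⟨_, hv, _⟩ => hv rfl⟩

open Classical in
/-- The adjacency matrix of a graph on `{0, …, n - 1}`, written as a tree. -/
noncomputable def encodeGraph {n : ℕ} (G : SimpleGraph (Fin n)) : Data :=
  Data.ofList (List.ofFn fun i => Data.ofList (List.ofFn fun j =>
    Data.ofBool (decide (G.Adj i j))))

/-- A coloring, written as a tree: the list of the colors of the vertices. -/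
def encodeColoring {n k : ℕ} {G : SimpleGraph (Fin n)} (α : G.Coloring (Fin k)) : Data :=
  Data.ofList (List.ofFn fun v => Data.ofNat (α v).val)

/-- `ℓ`-Length `k`-Color Path, parameterized by `ℓ`.  An instance consists of a graph `G`, a
number `k` of colors (in unary) and two `k`-colorings `α`, `β` of `G`; the question is whether
the `k`-color graph of `G` contains a path from `α` to `β` of length at most `ℓ`. -/
def LengthColorPath : ParamProblem :=
  {p | ∃ (n k : ℕ) (G : SimpleGraph (Fin n)) (α β : G.Coloring (Fin k)),
    p.1 = Data.node (encodeGraph G)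
      (Data.node (Data.ofNat k) (Data.node (encodeColoring α) (encodeColoring β))) ∧
    ∃ w : (colorGraph G k).Walk α β, w.IsPath ∧ w.length ≤ p.2}

/-! Local certificates. A set of `k` true variables among `n` is written as a strictly increasing
sequence `x` with sentinels `x 0 = 0` and `x (k + 1) = n + 1`, whose remaining entries are the true
indices shifted by one. A window is a short list of pairs `(p, x p)`. One pair shows that a variable
is true, and two consecutive pairs that enclose it show that it is false. So in a part of the
circuit with depth at most `d` and no large gate, every value is determined by some window of at
most `2 ^ (d + 1)` pairs.

With weft one, a gate with the value that asks for all predecessors (true for a conjunction, false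
for a disjunction) may be large. Such a value is assumed instead of derived; the other value needs a
single predecessor. Hence a true output is certified by at most `2 ^ d` assumptions and one window
(`forces_sound`, `forces_complete`). A false assumption is refuted by a single window, because no
large gate lies below the assumed gate (`refutes_sound`, `refutes_complete`). Satisfiability thus
becomes the following choice problem: for each list of at most `2 ^ (d + 1)` positions (a block),
pick a candidate, that is, a window on these positions together with a certificate, such that each
candidate passes a local test and all are pairwise compatible
(`Circuit.WellFormed.exists_candidates_iff`). The number of blocks depends only on `k` and `d`, and
for fixed `d` there are polynomially many candidates.

Recoloring. A clique that uses all colors, the palette, can never be recolored and so imposes a list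
of colors on every other vertex. Candidate `c` has the list `{3 + c, 0}`, and incompatible
candidates are adjacent, so the candidates of color `0` are pairwise compatible. The selector of a
block may take the colors `1`, `2` and `3 + c` for the candidates `c` of the block; it is adjacent
to all candidates, so it takes `3 + c` only while candidate `c` has color `0`. The switch has to go
from `2` to `1` and is adjacent to all selectors; at that moment every selector avoids `1` and `2`
and therefore points at a candidate of color `0`. This yields the choice (`reduction_sound`).
Conversely, a choice gives a recoloring with at most `4 * bs.length + 1` steps
(`reduction_complete`).

What remains is to show that this reduction runs in polynomial time for fixed `d`; this rests on
closure properties of `PolyTime`, and `FptReduces.comp_polyTime` composes it with the given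
fpt-reduction. -/

/-! ### Sizes of trees and running times -/

theorem Data.one_le_size (x : Data) : 1 ≤ x.size := by
  cases x <;> simp [Data.size]

theorem Data.size_fst_le (x : Data) : x.fst.size ≤ x.size := by
  rcases x with _ | ⟨a, b⟩
  · rfl
  · change a.size ≤ a.size + b.size + 1
    omega

theorem Data.size_snd_le (x : Data) : x.snd.size ≤ x.size := by
  rcases x with _ | ⟨a, b⟩
  · rfl
  · change b.size ≤ a.size + b.size + 1
    omega

/-- Every instruction pays for the tree it is applied to. Time bounds therefore bound intermediate
results, which is what makes polynomial running times compose. -/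
theorem Prog.Run.size_le {p : Prog} {x y : Data} {t : ℕ} (h : p.Run x y t) :
    y.size ≤ t ∧ x.size + 1 ≤ t := by
  induction h with
  | id x => omega
  | nil x => simp [Data.size]
  | fst x => have := x.size_fst_le; omega
  | snd x => have := x.size_snd_le; omega
  | eqTest x =>
    refine ⟨?_, by omega⟩
    cases x with
    | nil => simp [Data.size, Data.eqTest]
    | node a b =>
      have := a.one_le_size
      have := b.one_le_size
      simp only [Data.eqTest]
      (split <;> simp [Data.size]); omega
  | pair _ _ ih ih' => simp [Data.size]; omega
  | seq _ _ ih ih' => omega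
  | ite_true _ _ _ ih ih' => omega
  | ite_false _ _ ih ih' => omega
  | while_stop _ ih => omega
  | while_step _ _ _ _ ih ih' ih'' => omega

/-! ### Polynomially bounded functions -/

/-- `b` is bounded by a polynomial. -/
def PolyBd (b : ℕ → ℕ) : Prop := ∃ c, ∀ n, b n ≤ (n + 2) ^ c

namespace PolyBd

theorem id : PolyBd fun n => n := ⟨1, fun n => by simp⟩

theorem const (k : ℕ) : PolyBd fun _ => k :=
  -- The base `n + 2` is at least `2` even for `n = 0`, so `k ≤ 2 ^ k` suffices.
  ⟨k, fun n => (Nat.lt_two_pow_self.le).trans (Nat.pow_le_pow_left (by omega) k)⟩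

theorem mul {f g : ℕ → ℕ} (hf : PolyBd f) (hg : PolyBd g) : PolyBd fun n => f n * g n :=
  let ⟨c, hc⟩ := hf
  let ⟨d, hd⟩ := hg
  ⟨c + d, fun n => (Nat.mul_le_mul (hc n) (hd n)).trans (pow_add _ _ _).ge⟩

theorem add {f g : ℕ → ℕ} (hf : PolyBd f) (hg : PolyBd g) : PolyBd fun n => f n + g n := by
  obtain ⟨c, hc⟩ := hf
  obtain ⟨d, hd⟩ := hg
  refine ⟨max c d + 1, fun n => ?_⟩
  have h1 := (hc n).trans (Nat.pow_le_pow_right (n := n + 2) (by omega) (le_max_left c d))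
  have h2 := (hd n).trans (Nat.pow_le_pow_right (n := n + 2) (by omega) (le_max_right c d))
  rw [pow_succ]
  nlinarith

theorem pow {f : ℕ → ℕ} (hf : PolyBd f) (c : ℕ) : PolyBd fun n => f n ^ c :=
  let ⟨d, hd⟩ := hf
  ⟨d * c, fun n => (Nat.pow_le_pow_left (hd n) c).trans (pow_mul _ _ _).ge⟩

end PolyBd

/-! ### Types encoded by trees -/

/-- An injective encoding of the elements of a type by trees. -/
class Enc (α : Type) where
  enc : α → Data
  inj : Function.Injective enc

open Enc (enc)

/-- The size of the encoding of an element. -/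
def esize {α : Type} [Enc α] (a : α) : ℕ := (enc a).size

theorem one_le_esize {α : Type} [Enc α] (a : α) : 1 ≤ esize a := (enc a).one_le_size

theorem Data.ofNat_injective : Function.Injective Data.ofNat := by
  intro m
  induction m with
  | zero => rintro (_ | n) h <;> simp_all [Data.ofNat]
  | succ m ih =>
    rintro (_ | n) h
    · simp [Data.ofNat] at h
    · simp only [Data.ofNat, Data.node.injEq, true_and] at h
      rw [ih h]

theorem Data.ofList_injective : Function.Injective Data.ofList := by
  intro m
  induction m with
  | nil => rintro (_ | n) h <;> simp_all [Data.ofList]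
  | cons a m ih =>
    rintro (_ | ⟨b, n⟩) h
    · simp [Data.ofList] at h
    · simp only [Data.ofList, Data.node.injEq] at h
      rw [ih h.2, h.1]

instance : Enc Data := ⟨fun x => x, fun _ _ h => h⟩

instance : Enc Unit := ⟨fun _ => Data.nil, fun _ _ _ => rfl⟩

instance : Enc ℕ := ⟨Data.ofNat, Data.ofNat_injective⟩

instance : Enc Bool := ⟨Data.ofBool, by decide⟩

instance {α β : Type} [Enc α] [Enc β] : Enc (α × β) :=
  ⟨fun p => Data.node (enc p.1) (enc p.2), fun p q h => by
    simp only [Data.node.injEq] at h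
    exact Prod.ext (Enc.inj h.1) (Enc.inj h.2)⟩

instance {α : Type} [Enc α] : Enc (List α) :=
  ⟨fun l => Data.ofList (l.map enc),
    Data.ofList_injective.comp (List.map_injective_iff.2 Enc.inj)⟩

/-- One round of the loop that folds `step` over a list. -/
def PolyTime.foldBody {α β γ : Type} (step : α → γ → β → γ) : (α × γ) × List β → (α × γ) × List β
  | (s, []) => (s, [])
  | ((a, c), b :: l) => ((a, step a c b), l)

/-- The loop invariant. It holds for all `i`, since the body does nothing once the list is
exhausted. -/
theorem PolyTime.foldBody_iterate {α β γ : Type} (step : α → γ → β → γ) (a : α) (c : γ) (i : ℕ)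
    (l : List β) :
    (PolyTime.foldBody step)^[i] ((a, c), l) = ((a, (l.take i).foldl (step a) c), l.drop i) := by
  induction i generalizing c l with
  | zero => rfl
  | succ i ih =>
    rw [Function.iterate_succ_apply]
    cases l with
    | nil => rw [PolyTime.foldBody, ih]; simp
    | cons b l => rw [PolyTime.foldBody, ih]; rfl

section

variable {α β γ δ : Type} [Enc α] [Enc β] [Enc γ] [Enc δ]

theorem enc_prod (p : α × β) : enc p = Data.node (enc p.1) (enc p.2) := rfl

theorem enc_nil : enc ([] : List α) = Data.nil := rfl

theorem enc_cons (a : α) (l : List α) : enc (a :: l) = Data.node (enc a) (enc l) := rfl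

theorem enc_succ (n : ℕ) : enc (n + 1) = Data.node Data.nil (enc n) := rfl

theorem esize_prod (p : α × β) : esize p = esize p.1 + esize p.2 + 1 := rfl

theorem esize_nil : esize ([] : List α) = 1 := rfl

theorem esize_cons (a : α) (l : List α) : esize (a :: l) = esize a + esize l + 1 := rfl

theorem esize_bool_le (b : Bool) : esize b ≤ 3 := by cases b <;> decide

theorem esize_nat (n : ℕ) : esize n = 2 * n + 1 := by
  induction n with
  | zero => rfl
  | succ n ih =>
    have : esize (n + 1) = 1 + esize n + 1 := rfl
    omega

theorem length_lt_esize (l : List α) : l.length < esize l := by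
  induction l with
  | nil => simp [esize_nil]
  | cons a l ih => simp [esize_cons]; omega

theorem esize_append (l l' : List α) : esize (l ++ l') + 1 = esize l + esize l' := by
  induction l with
  | nil => simp [esize_nil]; omega
  | cons a l ih => simp [esize_cons]; omega

theorem esize_reverse (l : List α) : esize l.reverse = esize l := by
  induction l with
  | nil => rfl
  | cons a l ih =>
    have := esize_append l.reverse [a]
    simp [esize_cons, esize_nil] at *; omega

theorem esize_le_of_mem {a : α} {l : List α} (h : a ∈ l) : esize a ≤ esize l := by
  induction l with
  | nil => simp at h
  | cons b l ih =>
    rw [esize_cons]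
    rcases List.mem_cons.1 h with rfl | h
    · omega
    · have := ih h; omega

/-! ### Polynomial-time functions -/

/-- `f` is computed, on encodings, by a program that runs in polynomial time. -/
@[fun_prop]
def PolyTime (f : α → β) : Prop :=
  ∃ (p : Prog) (c : ℕ), ∀ a, ∃ t, p.Run (enc a) (enc (f a)) t ∧ t ≤ (esize a + 2) ^ c

namespace PolyTime

theorem of_run {f : α → β} (p : Prog) {b : ℕ → ℕ} (hb : PolyBd b)
    (h : ∀ a, ∃ t, p.Run (enc a) (enc (f a)) t ∧ t ≤ b (esize a)) : PolyTime f :=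
  let ⟨c, hc⟩ := hb
  ⟨p, c, fun a => let ⟨t, ht, h⟩ := h a; ⟨t, ht, h.trans (hc _)⟩⟩

theorem esize_le {f : α → β} (hf : PolyTime f) : ∃ c, ∀ a, esize (f a) ≤ (esize a + 2) ^ c :=
  let ⟨_, c, h⟩ := hf
  ⟨c, fun a => let ⟨_, ht, h⟩ := h a; ht.size_le.1.trans h⟩

/-- Programs see only encodings, so the same program computes `g`, even with another codomain. Many
operations on lists and numbers are obtained from operations on trees in this way. -/
theorem of_enc_eq {f : α → β} (hf : PolyTime f) {g : α → γ} (h : ∀ a, enc (g a) = enc (f a)) :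
    PolyTime g :=
  let ⟨p, c, hp⟩ := hf
  ⟨p, c, fun a => by rw [h]; exact hp a⟩

theorem poly_one_add : PolyBd fun n => 1 + n := (PolyBd.const 1).add PolyBd.id

@[fun_prop]
theorem id : PolyTime (fun a : α => a) :=
  of_run Prog.id poly_one_add fun _ => ⟨_, Prog.Run.id _, le_rfl⟩

@[fun_prop]
theorem comp {g : β → γ} {f : α → β} (hg : PolyTime g) (hf : PolyTime f) :
    PolyTime (fun a => g (f a)) := by
  obtain ⟨p, c, hp⟩ := hf
  obtain ⟨q, d, hq⟩ := hg
  refine of_run (p.seq q) (b := fun n => (n + 2) ^ c + ((n + 2) ^ c + 2) ^ d + (1 + n)) ?_ ?_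
  · have h : PolyBd fun n => (n + 2) ^ c := ⟨c, fun _ => le_rfl⟩
    exact (h.add ((h.add (.const 2)).pow d)).add poly_one_add
  · intro a
    obtain ⟨s, hs, hs'⟩ := hp a
    obtain ⟨t, ht, ht'⟩ := hq (f a)
    refine ⟨_, Prog.Run.seq hs ht, ?_⟩
    have h1 : esize (f a) ≤ (esize a + 2) ^ c := hs.size_le.1.trans hs'
    have h2 := Nat.pow_le_pow_left (Nat.add_le_add_right h1 2) d
    exact Nat.add_le_add (Nat.add_le_add hs' (ht'.trans h2)) le_rfl

theorem poly_two (c d : ℕ) : PolyBd fun n => (n + 2) ^ c + (n + 2) ^ d + (1 + n) :=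
  PolyBd.add (PolyBd.add ⟨c, fun _ => le_rfl⟩ ⟨d, fun _ => le_rfl⟩) poly_one_add

@[fun_prop]
theorem pair {f : α → β} {g : α → γ} (hf : PolyTime f) (hg : PolyTime g) :
    PolyTime (fun a => (f a, g a)) := by
  obtain ⟨p, c, hp⟩ := hf
  obtain ⟨q, d, hq⟩ := hg
  refine of_run (p.pair q) (poly_two c d) fun a => ?_
  obtain ⟨s, hs, hs'⟩ := hp a
  obtain ⟨t, ht, ht'⟩ := hq a
  exact ⟨_, Prog.Run.pair hs ht, Nat.add_le_add (Nat.add_le_add hs' ht') le_rfl⟩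

theorem fst' : PolyTime (Prod.fst : α × β → α) :=
  of_run Prog.fst poly_one_add fun _ => ⟨_, Prog.Run.fst _, le_rfl⟩

theorem snd' : PolyTime (Prod.snd : α × β → β) :=
  of_run Prog.snd poly_one_add fun _ => ⟨_, Prog.Run.snd _, le_rfl⟩

@[fun_prop]
theorem fst {f : α → β × γ} (hf : PolyTime f) : PolyTime (fun a => (f a).1) := fst'.comp hf

@[fun_prop]
theorem snd {f : α → β × γ} (hf : PolyTime f) : PolyTime (fun a => (f a).2) := snd'.comp hf

@[fun_prop]
theorem dataFst {f : α → Data} (hf : PolyTime f) : PolyTime (fun a => (f a).fst) :=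
  (of_run (f := Data.fst) Prog.fst poly_one_add fun _ => ⟨_, Prog.Run.fst _, le_rfl⟩).comp hf

@[fun_prop]
theorem dataSnd {f : α → Data} (hf : PolyTime f) : PolyTime (fun a => (f a).snd) :=
  (of_run (f := Data.snd) Prog.snd poly_one_add fun _ => ⟨_, Prog.Run.snd _, le_rfl⟩).comp hf

@[fun_prop]
theorem dataNode {f g : α → Data} (hf : PolyTime f) (hg : PolyTime g) :
    PolyTime (fun a => Data.node (f a) (g a)) :=
  (hf.pair hg).of_enc_eq fun _ => rfl

@[fun_prop]
theorem encode {f : α → β} (hf : PolyTime f) : PolyTime (fun a => enc (f a)) :=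
  hf.of_enc_eq fun _ => rfl

theorem const_data (x : Data) : PolyTime (fun _ : α => x) := by
  induction x with
  | nil => exact of_run Prog.nil poly_one_add fun _ => ⟨_, Prog.Run.nil _, le_rfl⟩
  | node x y hx hy => exact hx.dataNode hy

@[fun_prop]
theorem const (b : β) : PolyTime (fun _ : α => b) :=
  (const_data (enc b)).of_enc_eq fun _ => rfl

@[fun_prop]
theorem cons {f : α → β} {l : α → List β} (hf : PolyTime f) (hl : PolyTime l) :
    PolyTime (fun a => f a :: l a) :=
  (hf.pair hl).of_enc_eq fun _ => rfl

@[fun_prop]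
theorem tail {l : α → List β} (hl : PolyTime l) : PolyTime (fun a => (l a).tail) :=
  (hl.encode.dataSnd).of_enc_eq fun a => by cases l a <;> rfl

theorem enc_bool_ne_nil {b : Bool} : enc b ≠ Data.nil ↔ b = true := by cases b <;> decide

/-- The program may test any value that is encoded by the empty tree iff the condition fails. -/
theorem ite_of_enc {P : α → Prop} [∀ a, Decidable (P a)] {c : α → δ} {f g : α → β}
    (hc : PolyTime c) (h : ∀ a, enc (c a) ≠ Data.nil ↔ P a) (hf : PolyTime f) (hg : PolyTime g) :
    PolyTime (fun a => if P a then f a else g a) := by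
  obtain ⟨r, e, hr⟩ := hc
  obtain ⟨p, c, hp⟩ := hf
  obtain ⟨q, d, hq⟩ := hg
  refine of_run (Prog.ite r p q)
    (b := fun n => (n + 2) ^ e + ((n + 2) ^ c + (n + 2) ^ d) + (1 + n)) ?_ fun a => ?_
  · exact PolyBd.add (PolyBd.add ⟨e, fun _ => le_rfl⟩
      (PolyBd.add ⟨c, fun _ => le_rfl⟩ ⟨d, fun _ => le_rfl⟩)) poly_one_add
  · obtain ⟨u, hu, hu'⟩ := hr a
    obtain ⟨s, hs, hs'⟩ := hp a
    obtain ⟨t, ht, ht'⟩ := hq a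
    by_cases hP : P a
    · rw [if_pos hP]
      exact ⟨_, Prog.Run.ite_true hu ((h a).2 hP) hs, Nat.add_le_add
        (Nat.add_le_add hu' (hs'.trans (Nat.le_add_right _ _))) le_rfl⟩
    · rw [if_neg hP]
      have hn : enc _ = Data.nil := not_not.1 ((not_congr (h a)).2 hP)
      rw [hn] at hu
      exact ⟨_, Prog.Run.ite_false hu ht, Nat.add_le_add
        (Nat.add_le_add hu' (ht'.trans (Nat.le_add_left _ _))) le_rfl⟩

@[fun_prop]
theorem ite {P : α → Prop} [∀ a, Decidable (P a)] {f g : α → β}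
    (hc : PolyTime (fun a => decide (P a))) (hf : PolyTime f) (hg : PolyTime g) :
    PolyTime (fun a => if P a then f a else g a) :=
  ite_of_enc hc (fun a => by rw [enc_bool_ne_nil, decide_eq_true_iff]) hf hg

@[fun_prop]
theorem decide_eq_true {f : α → Bool} (hf : PolyTime f) :
    PolyTime (fun a => decide (f a = true)) := by
  simpa using hf

@[fun_prop]
theorem cond {c : α → Bool} {f g : α → β} (hc : PolyTime c) (hf : PolyTime f) (hg : PolyTime g) :
    PolyTime (fun a => bif c a then f a else g a) := by
  simp only [Bool.cond_eq_ite]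
  fun_prop

@[fun_prop]
theorem not {c : α → Bool} (hc : PolyTime c) : PolyTime (fun a => !(c a)) := by
  have : (fun a => !(c a)) = fun a => bif c a then false else true := by
    funext a; cases c a <;> rfl
  rw [this]; fun_prop

@[fun_prop]
theorem and {c d : α → Bool} (hc : PolyTime c) (hd : PolyTime d) :
    PolyTime (fun a => c a && d a) := by
  have : (fun a => c a && d a) = fun a => bif c a then d a else false := by
    funext a; cases c a <;> rfl
  rw [this]; fun_prop

@[fun_prop]
theorem or {c d : α → Bool} (hc : PolyTime c) (hd : PolyTime d) :
    PolyTime (fun a => c a || d a) := by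
  have : (fun a => c a || d a) = fun a => bif c a then true else d a := by
    funext a; cases c a <;> rfl
  rw [this]; fun_prop

@[fun_prop]
-- Encodings are injective, so equality may be tested on trees.
theorem decide_eq [DecidableEq β] {f g : α → β} (hf : PolyTime f) (hg : PolyTime g) :
    PolyTime (fun a => decide (f a = g a)) := by
  have h : PolyTime Data.eqTest :=
    of_run Prog.eqTest poly_one_add fun _ => ⟨_, Prog.Run.eqTest _, le_rfl⟩
  refine (h.comp (hf.encode.dataNode hg.encode)).of_enc_eq fun a => ?_
  by_cases e : f a = g a
  · simp [e, Data.eqTest, enc, Data.ofBool]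
  · have : enc (f a) ≠ enc (g a) := fun h => e (Enc.inj h)
    simp only [e, Data.eqTest, this]; rfl

/-! ### Loops -/

/-- With `D` above the cost of each test, of each body and of the overhead, a round costs at most `3
* D`; there are `n` full rounds and a final test. -/
theorem while_run {σ : Type} [Enc σ] {test : σ → Bool} {body : σ → σ} {pt pb : Prog}
    {D : ℕ} (n : ℕ) (s : σ)
    (ht : ∀ i ≤ n, ∃ t ≤ D, pt.Run (enc (body^[i] s)) (enc (test (body^[i] s))) t)
    (hb : ∀ i ≤ n, ∃ t ≤ D, pb.Run (enc (body^[i] s)) (enc (body (body^[i] s))) t)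
    (hs : ∀ i ≤ n, 1 + esize (body^[i] s) ≤ D)
    (h1 : ∀ i < n, test (body^[i] s) = true) (h2 : test (body^[n] s) = false) :
    ∃ t, (Prog.while pt pb).Run (enc s) (enc (body^[n] s)) t ∧ t ≤ (n + 1) * (D * 3) := by
  induction n generalizing s with
  | zero =>
    obtain ⟨t, ht', h⟩ := ht 0 le_rfl
    rw [h2] at h
    refine ⟨_, Prog.Run.while_stop h, ?_⟩
    have := hs 0 le_rfl
    simp only [Function.iterate_zero, _root_.id] at *
    unfold esize at this
    omega
  | succ n ih =>
    obtain ⟨t, ht', h⟩ := ht 0 (by omega)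
    obtain ⟨u, hu', hu⟩ := hb 0 (by omega)
    have h0 := hs 0 (by omega)
    obtain ⟨v, hv, hv'⟩ := ih (body s) (fun i hi => ht (i + 1) (by omega))
      (fun i hi => hb (i + 1) (by omega)) (fun i hi => hs (i + 1) (by omega))
      (fun i hi => h1 (i + 1) (by omega)) h2
    refine ⟨_, Prog.Run.while_step h (enc_bool_ne_nil.2 (h1 0 (by omega))) hu hv, ?_⟩
    rw [Function.iterate_zero] at *
    unfold esize at h0
    simp only [_root_.id] at h0 ⊢
    nlinarith

/-- Polynomially many rounds of a polynomial-time body do not suffice by themselves, because the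
state could grow exponentially. Hence `hs`, a bound on all intermediate states in terms of the
original input. -/
theorem iterate {σ : Type} [Enc σ] {test : σ → Bool} {body : σ → σ} (n : σ → ℕ)
    (ht : PolyTime test) (hb : PolyTime body)
    (h1 : ∀ s, ∀ i < n s, test (body^[i] s) = true) (h2 : ∀ s, test (body^[n s] s) = false)
    (hn : ∃ c, ∀ s, n s ≤ (esize s + 2) ^ c)
    {ι : Type} [Enc ι] {start : ι → σ} (hi : PolyTime start)
    (hs : ∃ c, ∀ a, ∀ i ≤ n (start a), esize (body^[i] (start a)) ≤ (esize a + 2) ^ c) :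
    PolyTime fun a => body^[n (start a)] (start a) := by
  obtain ⟨pt, ct, ht⟩ := ht
  obtain ⟨pb, cb, hb⟩ := hb
  obtain ⟨pi, ci, hi⟩ := hi
  obtain ⟨cn, hn⟩ := hn
  obtain ⟨cs, hs⟩ := hs
  -- `B` bounds the states and `D` bounds the parts of a round; `b` adds the cost of producing the
  -- start state, the whole loop and the overhead of `seq`.
  let B : ℕ → ℕ := fun n => (n + 2) ^ cs
  let D : ℕ → ℕ := fun n => (B n + 2) ^ ct + (B n + 2) ^ cb + (1 + B n)
  let b : ℕ → ℕ := fun n =>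
    (n + 2) ^ ci + (((n + 2) ^ ci + 2) ^ cn + 1) * (D n * 3) + (1 + n)
  have hB : PolyBd B := ⟨cs, fun _ => le_rfl⟩
  have hI : PolyBd fun n => (n + 2) ^ ci := ⟨ci, fun _ => le_rfl⟩
  have hD : PolyBd D := (((hB.add (.const 2)).pow ct).add ((hB.add (.const 2)).pow cb)).add
    ((PolyBd.const 1).add hB)
  have hbb : PolyBd b := (hI.add ((((hI.add (.const 2)).pow cn).add (.const 1)).mul
    (hD.mul (.const 3)))).add poly_one_add
  refine of_run (pi.seq (Prog.while pt pb)) hbb fun a => ?_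
  obtain ⟨u, hu, hu'⟩ := hi a
  have key (i : ℕ) (hi : i ≤ n (start a)) (c : ℕ) :
      (esize (body^[i] (start a)) + 2) ^ c ≤ (B (esize a) + 2) ^ c :=
    Nat.pow_le_pow_left (Nat.add_le_add_right (hs a i hi) 2) c
  obtain ⟨t, hr, hle⟩ := while_run (D := D (esize a)) (pt := pt) (pb := pb) (n (start a)) (start a)
    (fun i hi => by
      obtain ⟨t, hr, hle⟩ := ht (body^[i] (start a))
      exact ⟨t, hle.trans ((key i hi ct).trans (by simp only [D]; omega)), hr⟩)
    (fun i hi => by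
      obtain ⟨t, hr, hle⟩ := hb (body^[i] (start a))
      exact ⟨t, hle.trans ((key i hi cb).trans (by simp only [D]; omega)), hr⟩)
    (fun i hi => by
      have := hs a i hi
      simp only [D, B]; omega)
    (h1 _) (h2 _)
  refine ⟨_, Prog.Run.seq hu hr, ?_⟩
  have h3 : n (start a) ≤ ((esize a + 2) ^ ci + 2) ^ cn :=
    (hn _).trans (Nat.pow_le_pow_left (Nat.add_le_add_right (hu.size_le.1.trans hu') 2) cn)
  have h4 : t ≤ (((esize a + 2) ^ ci + 2) ^ cn + 1) * (D (esize a) * 3) :=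
    hle.trans (Nat.mul_le_mul_right _ (Nat.add_le_add_right h3 1))
  exact Nat.add_le_add (Nat.add_le_add hu' h4) le_rfl

theorem isEmpty {l : α → List β} (hl : PolyTime l) : PolyTime (fun a => (l a).isEmpty) := by
  have := ite_of_enc (P := fun a => l a ≠ []) (f := fun _ => false) (g := fun _ => true) hl
    (fun a => by cases l a <;> simp [enc_nil, enc_cons]) (const _) (const _)
  refine this.of_enc_eq fun a => ?_
  cases l a <;> rfl

theorem foldBody_polyTime {step : α → γ → β → γ}
    (hs : PolyTime fun p : (α × γ) × β => step p.1.1 p.1.2 p.2) :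
    PolyTime (foldBody step) := by
  obtain ⟨q, e, hq⟩ := hs
  have hc : PolyTime fun s : (α × γ) × List β => s.2 := by fun_prop
  obtain ⟨r, d, hr⟩ := hc
  -- The test returns the encoded rest of the list, which is the empty tree exactly at the end;
  -- otherwise `((a, step a c b), l)` is assembled from projections and one call of `q`.
  let p : Prog := Prog.ite Prog.snd
    (((Prog.fst.seq Prog.fst).pair ((Prog.fst.pair (Prog.snd.seq Prog.fst)).seq q)).pair
      (Prog.snd.seq Prog.snd)) Prog.id
  -- Besides the call of `q` there is a constant number of instructions, each on a tree no larger
  -- than the state; `100` is a generous constant.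
  refine of_run p (b := fun n => (n + 2) ^ e + 100 * (n + 2)) ?_ ?_
  · exact PolyBd.add ⟨e, fun _ => le_rfl⟩ ((PolyBd.const 100).mul ⟨1, fun n => by simp⟩)
  · rintro ⟨⟨a, c⟩, l⟩
    cases l with
    | nil =>
      refine ⟨_, Prog.Run.ite_false (Prog.Run.snd _) (Prog.Run.id _), ?_⟩
      unfold esize; omega
    | cons b l =>
      obtain ⟨t, ht, hle⟩ := hq ((a, c), b)
      have hsz : esize ((a, c), b) ≤ esize ((a, c), b :: l) := by
        simp only [esize_prod, esize_cons]; omega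
      have hle' := hle.trans (Nat.pow_le_pow_left (Nat.add_le_add_right hsz 2) e)
      refine ⟨_, Prog.Run.ite_true (Prog.Run.snd _) (by simp [enc_prod, enc_cons, Data.snd])
        (.pair (.pair (.seq (.fst _) (.fst _))
          (.seq (.pair (.fst _) (.seq (.snd _) (.fst _))) ht)) (.seq (.snd _) (.snd _))), ?_⟩
      have h1 := Data.size_fst_le (enc ((a, c), b :: l))
      have h2 := Data.size_snd_le (enc ((a, c), b :: l))
      change _ ≤ (esize ((a, c), b :: l) + 2) ^ e + 100 * (esize ((a, c), b :: l) + 2)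
      have h3 : (enc ((a, c), b :: l)).size = esize ((a, c), b :: l) := rfl
      omega

/-- The size condition concerns the accumulator after every prefix of the list; this is the bound on
states that `iterate` requires. -/
theorem foldl {step : α → γ → β → γ} {start : α → γ} {l : α → List β}
    (hs : PolyTime fun p : (α × γ) × β => step p.1.1 p.1.2 p.2)
    (hi : PolyTime start) (hl : PolyTime l)
    (hsize : ∃ c, ∀ a, ∀ l₁ l₂, l a = l₁ ++ l₂ →
      esize (l₁.foldl (step a) (start a)) ≤ (esize a + 2) ^ c) :
    PolyTime fun a => (l a).foldl (step a) (start a) := by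
  have key := iterate (test := fun s : (α × γ) × List β => !s.2.isEmpty) (body := foldBody step)
    (fun s => s.2.length) (isEmpty (by fun_prop)).not (foldBody_polyTime hs) ?_ ?_
    ⟨1, ?_⟩ (start := fun a => ((a, start a), l a)) (by fun_prop) ?_
  · refine key.fst.snd.of_enc_eq fun a => ?_
    rw [foldBody_iterate, List.take_length]
  · rintro ⟨⟨a, c⟩, l⟩ i hi
    rw [foldBody_iterate]
    simpa using hi
  · rintro ⟨⟨a, c⟩, l⟩
    rw [foldBody_iterate]
    simp
  · rintro ⟨s, l⟩
    have := length_lt_esize l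
    simp only [esize_prod, pow_one]; omega
  · obtain ⟨c, hc⟩ := hsize
    obtain ⟨d, hd⟩ := hl.esize_le
    have hP : PolyBd fun n => n + (n + 2) ^ c + 1 + (n + 2) ^ d + 1 :=
      (((PolyBd.id.add ⟨c, fun _ => le_rfl⟩).add (.const 1)).add ⟨d, fun _ => le_rfl⟩).add
        (.const 1)
    obtain ⟨e, he⟩ := hP
    refine ⟨e, fun a i _ => le_trans ?_ (he (esize a))⟩
    rw [foldBody_iterate]
    have h1 := hc a _ _ (List.take_append_drop i (l a)).symm
    have h2 := esize_append ((l a).take i) ((l a).drop i)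
    rw [List.take_append_drop] at h2
    have h3 := hd a
    have h4 := one_le_esize ((l a).take i)
    simp only [esize_prod]
    omega

end PolyTime

end

/-! ### Polynomial-time operations on lists and unary numbers -/

section

variable {α β γ δ : Type} [Enc α] [Enc β] [Enc γ] [Enc δ]

namespace PolyTime

@[fun_prop]
theorem any {l : α → List β} {g : α → β → Bool} (hl : PolyTime l)
    (hg : PolyTime fun p : α × β => g p.1 p.2) : PolyTime fun a => (l a).any (g a) := by
  have h := foldl (step := fun a (c : Bool) b => c || g a b) (start := fun _ : α => false) (l := l)
    (by fun_prop) (by fun_prop) hl ⟨2, fun a l₁ _ _ => ?_⟩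
  · refine h.of_enc_eq fun a => ?_
    have (c : Bool) : (l a).foldl (fun c b => c || g a b) c = (c || (l a).any (g a)) := by
      induction l a generalizing c with
      | nil => simp
      | cons b l ih => simp [ih, Bool.or_assoc]
    simp [this]
  · have := esize_bool_le (l₁.foldl (fun c b => c || g a b) false)
    have : 2 ^ 2 ≤ (esize a + 2) ^ 2 := Nat.pow_le_pow_left (by omega) 2
    omega

@[fun_prop]
theorem all {l : α → List β} {g : α → β → Bool} (hl : PolyTime l)
    (hg : PolyTime fun p : α × β => g p.1 p.2) : PolyTime fun a => (l a).all (g a) := by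
  have : PolyTime fun a => !(l a).any fun b => !g a b := by fun_prop
  refine this.of_enc_eq fun a => ?_
  rw [List.all_eq_not_any_not]

@[fun_prop]
theorem append {l m : α → List β} (hl : PolyTime l) (hm : PolyTime m) :
    PolyTime fun a => l a ++ m a := by
  -- A fold that conses reverses its list, so appending takes two such folds.
  have hrev {l : α → List β} (hl : PolyTime l) {m : α → List β} (hm : PolyTime m) :
      PolyTime fun a => (l a).foldl (fun c b => b :: c) (m a) := by
    refine foldl (step := fun _ c b => b :: c) (by fun_prop) hm hl ?_
    obtain ⟨c, hc⟩ := hl.esize_le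
    obtain ⟨d, hd⟩ := hm.esize_le
    obtain ⟨e, he⟩ := PolyBd.add (f := fun n => (n + 2) ^ c) (g := fun n => (n + 2) ^ d)
      ⟨c, fun _ => le_rfl⟩ ⟨d, fun _ => le_rfl⟩
    refine ⟨e, fun a l₁ l₂ h => le_trans ?_ (he (esize a))⟩
    have h1 := hc a
    have h2 := hd a
    have h3 := esize_append l₁ l₂
    have h4 := esize_append l₁.reverse (m a)
    have h5 := one_le_esize l₂
    rw [esize_reverse] at h4
    rw [h] at h1
    rw [List.foldl_flip_cons_eq_append']
    change _ ≤ _ + _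
    omega
  refine (hrev (hrev hl (const [])) hm).of_enc_eq fun a => ?_
  simp

@[fun_prop]
theorem reverse {l : α → List β} (hl : PolyTime l) : PolyTime fun a => (l a).reverse := by
  have : PolyTime fun a => (l a).foldl (fun c b => b :: c) [] := by
    refine foldl (step := fun _ c b => b :: c) (by fun_prop) (const _) hl ?_
    obtain ⟨c, hc⟩ := hl.esize_le
    refine ⟨c, fun a l₁ l₂ h => le_trans ?_ (hc a)⟩
    have h3 := esize_append l₁ l₂
    have h5 := one_le_esize l₂
    simp only [List.foldl_flip_cons_eq_append', List.append_nil, esize_reverse, h]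
    omega
  refine this.of_enc_eq fun a => ?_
  simp

@[fun_prop]
theorem flatten {l : α → List (List β)} (hl : PolyTime l) :
    PolyTime fun a => (l a).flatten := by
  have hf (l : List (List β)) (m : List β) :
      l.foldl (fun c b => c ++ b) m = m ++ l.flatten := by
    induction l generalizing m with
    | nil => simp
    | cons b l ih => simp [ih]
  have h := foldl (step := fun (_ : α) (c : List β) b => c ++ b) (start := fun _ => []) (l := l)
    (by fun_prop) (by fun_prop) hl ?_
  · refine h.of_enc_eq fun a => ?_
    rw [hf, List.nil_append]
  · obtain ⟨c, hc⟩ := hl.esize_le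
    refine ⟨c, fun a l₁ l₂ h => le_trans ?_ (hc a)⟩
    have h1 (l : List (List β)) : esize l.flatten ≤ esize l := by
      induction l with
      | nil => rfl
      | cons b l ih =>
        have := esize_append b l.flatten
        simp only [esize_cons, List.flatten_cons]
        omega
    have h3 := esize_append l₁ l₂
    have h5 := one_le_esize l₂
    have h6 := h1 l₁
    rw [h, hf, List.nil_append]
    omega

@[fun_prop]
theorem map {l : α → List β} {g : α → β → γ} (hl : PolyTime l)
    (hg : PolyTime fun p : α × β => g p.1 p.2) : PolyTime fun a => (l a).map (g a) := by
  have h := foldl (step := fun a (c : List γ) b => g a b :: c) (start := fun _ => []) (l := l)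
    (by fun_prop) (by fun_prop) hl ?_
  · refine h.reverse.of_enc_eq fun a => ?_
    have (l : List β) (c : List γ) :
        l.foldl (fun c b => g a b :: c) c = (l.map (g a)).reverse ++ c := by
      induction l generalizing c with
      | nil => simp
      | cons b l ih => simp [ih]
    simp [this]
  · obtain ⟨c, hc⟩ := hl.esize_le
    obtain ⟨d, hd⟩ := hg.esize_le
    have hC : PolyBd fun n => (n + 2) ^ c := ⟨c, fun _ => le_rfl⟩
    obtain ⟨e, he⟩ := (hC.mul (((((PolyBd.id.add hC).add (.const 1)).add
      (.const 2)).pow d).add (.const 1))).add (.const 1)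
    refine ⟨e, fun a l₁ l₂ h => le_trans ?_ (he (esize a))⟩
    -- Each element adds at most one image and one node to the accumulator, and the size of an image
    -- is bounded uniformly because list elements are no larger than the list.
    have key (l' : List β) (hm : ∀ b ∈ l', b ∈ l a) (m : List γ) :
        esize (l'.foldl (fun c b => g a b :: c) m) ≤
          l'.length * ((esize a + (esize a + 2) ^ c + 1 + 2) ^ d + 1) + esize m := by
      induction l' generalizing m with
      | nil => simp
      | cons b l' ih =>
        rw [List.foldl_cons]
        refine (ih (fun b hb => hm b (by simp [hb])) _).trans ?_
        have h1 : esize (a, b) ≤ esize a + (esize a + 2) ^ c + 1 := by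
          have := esize_le_of_mem (hm b (by simp))
          have := hc a
          simp only [esize_prod]
          omega
        have h2 := (hd (a, b)).trans (Nat.pow_le_pow_left (Nat.add_le_add_right h1 2) d)
        simp only [esize_cons, List.length_cons, add_mul] at h2 ⊢
        omega
    refine (key l₁ (fun b hb => by simp [h, hb]) []).trans ?_
    rw [esize_nil]
    have h3 : l₁.length ≤ (esize a + 2) ^ c := by
      have h4 := length_lt_esize (l a)
      have := hc a
      rw [h] at h4 this
      simp only [List.length_append] at h4
      omega
    exact Nat.add_le_add_right (Nat.mul_le_mul_right _ h3) 1

@[fun_prop]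
theorem flatMap {l : α → List β} {g : α → β → List γ} (hl : PolyTime l)
    (hg : PolyTime fun p : α × β => g p.1 p.2) : PolyTime fun a => (l a).flatMap (g a) := by
  simp only [List.flatMap]
  fun_prop

@[fun_prop]
theorem filter {l : α → List β} {g : α → β → Bool} (hl : PolyTime l)
    (hg : PolyTime fun p : α × β => g p.1 p.2) : PolyTime fun a => (l a).filter (g a) := by
  have : PolyTime fun a => (l a).flatMap fun b => if g a b then [b] else [] := by fun_prop
  refine this.of_enc_eq fun a => ?_
  congr 1
  induction l a with
  | nil => rfl
  | cons b l ih => rw [List.filter_cons, List.flatMap_cons, ih]; split <;> simp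

/-- A unary numeral is literally a list of units, so arithmetic is reduced to list operations. -/
theorem enc_replicate (n : ℕ) : enc (List.replicate n ()) = enc n := by
  induction n with
  | zero => rfl
  | succ n ih => rw [List.replicate_succ, enc_cons, ih, enc_succ]; rfl

@[fun_prop]
theorem replicate {n : α → ℕ} (hn : PolyTime n) :
    PolyTime fun a => List.replicate (n a) () :=
  hn.of_enc_eq fun _ => enc_replicate _

@[fun_prop]
theorem length {l : α → List β} (hl : PolyTime l) : PolyTime fun a => (l a).length := by
  have : PolyTime fun a => (l a).map fun _ => () := by fun_prop
  refine this.of_enc_eq fun a => ?_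
  rw [List.map_const', enc_replicate]

@[fun_prop]
theorem add {m n : α → ℕ} (hm : PolyTime m) (hn : PolyTime n) :
    PolyTime fun a => m a + n a := by
  have : PolyTime fun a => (List.replicate (m a) () ++ List.replicate (n a) ()).length := by
    fun_prop
  refine this.of_enc_eq fun a => ?_
  simp

@[fun_prop]
theorem drop {n : α → ℕ} {l : α → List β} (hn : PolyTime n) (hl : PolyTime l) :
    PolyTime fun a => (l a).drop (n a) := by
  have key (l : List β) (k : ℕ) :
      (List.replicate k ()).foldl (fun (c : List β) _ => c.tail) l = l.drop k := by
    induction k generalizing l with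
    | zero => rfl
    | succ k ih => rw [List.replicate_succ, List.foldl_cons, ih, List.drop_tail]
  have h := foldl (step := fun (_ : α) (c : List β) (_ : Unit) => c.tail) (start := l)
    (l := fun a => List.replicate (n a) ()) (by fun_prop) hl (by fun_prop) ?_
  · exact h.of_enc_eq fun a => by rw [key]
  · obtain ⟨c, hc⟩ := hl.esize_le
    refine ⟨c, fun a l₁ l₂ h => le_trans ?_ (hc a)⟩
    have hl₁ : l₁ = List.replicate l₁.length () := List.eq_replicate_of_mem fun _ _ => rfl
    generalize l₁.length = k at *
    subst hl₁
    rw [key]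
    have h3 := esize_append ((l a).take k) ((l a).drop k)
    have h5 := one_le_esize ((l a).take k)
    rw [List.take_append_drop] at h3
    omega

@[fun_prop]
theorem headD {l : α → List β} {d : α → β} (hl : PolyTime l) (hd : PolyTime d) :
    PolyTime fun a => (l a).headD (d a) := by
  have h1 : PolyTime fun a => (enc (l a)).fst := by fun_prop
  have : PolyTime fun a => if (l a).isEmpty then enc (d a) else (enc (l a)).fst :=
    ite hl.isEmpty.decide_eq_true hd.encode h1
  refine this.of_enc_eq fun a => ?_
  cases l a <;> rfl

@[fun_prop]
theorem getD {l : α → List β} {n : α → ℕ} {d : α → β} (hl : PolyTime l) (hn : PolyTime n)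
    (hd : PolyTime d) : PolyTime fun a => (l a).getD (n a) (d a) := by
  have : PolyTime fun a => ((l a).drop (n a)).headD (d a) := by fun_prop
  refine this.of_enc_eq fun a => ?_
  rw [List.getD_eq_getElem?_getD, List.headD_eq_head?_getD, List.head?_drop]

@[fun_prop]
theorem decide_lt {m n : α → ℕ} (hm : PolyTime m) (hn : PolyTime n) :
    PolyTime fun a => decide (m a < n a) := by
  have : PolyTime fun a => !((List.replicate (n a) ()).drop (m a)).isEmpty :=
    (isEmpty (by fun_prop)).not
  refine this.of_enc_eq fun a => ?_
  congr 1
  rw [Bool.eq_iff_iff]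
  simp
  omega

@[fun_prop]
theorem range {n : α → ℕ} (hn : PolyTime n) : PolyTime fun a => List.range (n a) := by
  have key (k : ℕ) : (List.replicate k ()).foldl (fun (c : List ℕ) _ => c.length :: c) [] =
      (List.range k).reverse := by
    induction k with
    | zero => rfl
    | succ k ih => 
      rw [List.replicate_succ', List.foldl_append, ih, List.range_succ]
      simp
  have h := foldl (step := fun (_ : α) (c : List ℕ) (_ : Unit) => c.length :: c)
    (start := fun _ => []) (l := fun a => List.replicate (n a) ()) (by fun_prop)
    (by fun_prop) (by fun_prop) ?_
  · refine h.reverse.of_enc_eq fun a => ?_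
    rw [key, List.reverse_reverse]
  · obtain ⟨c, hc⟩ := hn.esize_le
    -- The list of the numbers below `k` has quadratic size: the exponent `c * 2` covers the square,
    -- and the extra `2` provides a factor of at least `4`.
    refine ⟨c * 2 + 2, fun a l₁ l₂ h => ?_⟩
    have hlen : l₁.length ≤ n a := by
      have := congrArg List.length h
      simp at this; omega
    have hl₁ : l₁ = List.replicate l₁.length () := List.eq_replicate_of_mem fun _ _ => rfl
    generalize l₁.length = k at *
    subst hl₁
    rw [key, esize_reverse]
    have h2 (k : ℕ) : esize (List.range k) = k * (k + 1) + 1 := by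
      induction k with
      | zero => rfl
      | succ k ih =>
        have := esize_append (List.range k) [k]
        simp only [esize_cons, esize_nil, esize_nat] at this
        rw [List.range_succ]
        nlinarith
    rw [h2]
    have h3 := hc a
    rw [esize_nat] at h3
    rw [pow_add, pow_mul]
    have h4 : 2 ^ 2 ≤ (esize a + 2) ^ 2 := Nat.pow_le_pow_left (by omega) 2
    generalize (esize a + 2) ^ c = X at *
    generalize (esize a + 2) ^ 2 = Y at *
    have : k * (k + 1) + 1 ≤ X ^ 2 * 4 := by nlinarith
    exact this.trans (Nat.mul_le_mul_left _ h4)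

@[fun_prop]
theorem listProduct {l : α → List β} {m : α → List γ} (hl : PolyTime l) (hm : PolyTime m) :
    PolyTime fun a => l a ×ˢ m a := by
  have : PolyTime fun a => (l a).flatMap fun b => (m a).map fun c => (b, c) := by fun_prop
  exact this

@[fun_prop]
theorem contains [DecidableEq β] {l : α → List β} {b : α → β} (hl : PolyTime l)
    (hb : PolyTime b) : PolyTime fun a => decide (b a ∈ l a) := by
  have : PolyTime fun a => (l a).any fun c => decide (c = b a) := by fun_prop
  refine this.of_enc_eq fun a => ?_
  congr 1
  rw [Bool.eq_iff_iff]
  simp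

end PolyTime

end

/-! ### Circuits: recursion on gates -/

namespace Circuit

theorem foldl_sweep_length {β : Type} (step : List β → Gate → β) (l : List Gate) (acc : List β) :
    (l.foldl (fun acc g => acc ++ [step acc g]) acc).length = acc.length + l.length := by
  induction l generalizing acc with
  | nil => rfl
  | cons g l ih => rw [List.foldl_cons, ih]; simp; omega

/-- A sweep only appends, so values already computed never change. -/
theorem foldl_sweep_take {β : Type} (step : List β → Gate → β) (l : List Gate) (acc : List β) :
    (l.foldl (fun acc g => acc ++ [step acc g]) acc).take acc.length = acc := by
  induction l generalizing acc with
  | nil => simp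
  | cons g l ih =>
    have := congrArg (List.take acc.length) (ih (acc ++ [step acc g]))
    rw [List.take_take] at this
    simpa using this

theorem length_sweep {β : Type} (C : Circuit) (step : List β → Gate → β) :
    (C.sweep step).length = C.gates.length := by
  simp [sweep, foldl_sweep_length]

/-- Turns the left-to-right sweep into a recursion equation for single gates. Depth, weft and value
are all analyzed through it. -/
theorem sweep_getElem {β : Type} (C : Circuit) (step : List β → Gate → β) (i : ℕ)
    (h : i < C.gates.length) :
    (C.sweep step)[i]'(by rwa [length_sweep]) = step ((C.sweep step).take i) C.gates[i] := by
  have key : C.sweep step = (C.gates.drop (i + 1)).foldl (fun acc g => acc ++ [step acc g])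
      (((C.gates.take i).foldl (fun acc g => acc ++ [step acc g]) []) ++
        [step ((C.gates.take i).foldl (fun acc g => acc ++ [step acc g]) []) C.gates[i]]) := by
    conv_lhs => rw [sweep, ← List.take_append_drop i C.gates, List.drop_eq_getElem_cons h]
    rw [List.foldl_append, List.foldl_cons]
  set acc := (C.gates.take i).foldl (fun acc g => acc ++ [step acc g]) [] with hacc
  have hlen : acc.length = i := by
    rw [hacc, foldl_sweep_length]; simp; omega
  have h1 := foldl_sweep_take step (C.gates.drop (i + 1)) (acc ++ [step acc C.gates[i]])
  rw [← key] at h1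
  have h2 : (C.sweep step).take i = acc := by
    have := congrArg (List.take i) h1
    rw [List.take_take] at this
    simpa [hlen] using this
  have h3 : (C.sweep step)[i]? = some (step acc C.gates[i]) := by
    have := congrArg (fun l => l[i]?) h1
    simpa [List.getElem?_take, hlen] using this
  rw [h2]
  exact Option.some_injective _ ((List.getElem?_eq_getElem _).symm.trans h3)

theorem sweep_getD {β : Type} (C : Circuit) (step : List β → Gate → β) (d : β) (i : ℕ)
    (h : i < C.gates.length) :
    (C.sweep step).getD i d = step ((C.sweep step).take i) C.gates[i] := by
  rw [← sweep_getElem C step i h, List.getD_eq_getElem]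

theorem take_getD {β : Type} (l : List β) (d : β) {i j : ℕ} (h : j < i) :
    (l.take i).getD j d = l.getD j d := by
  simp [List.getD_eq_getElem?_getD, h]

theorem sweep_getLastD {β : Type} (C : Circuit) (step : List β → Gate → β) (d : β) :
    (C.sweep step).getLastD d = (C.sweep step).getD (C.gates.length - 1) d := by
  rw [← length_sweep C step, List.getLastD_eq_getLast?, List.getLast?_eq_getElem?,
    List.getD_eq_getElem?_getD]

end Circuit

/-! ### Uniform description of gates, and recursive tests for depth and weft -/

namespace Gate

/-- The kind of a gate, as in its encoding. -/
def tag : Gate → ℕ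
  | input _ => 0
  | neg _ => 1
  | conj _ => 2
  | disj _ => 3

/-- The variable that an input gate reads. -/
def var : Gate → ℕ
  | input i => i
  | _ => 0

/-- The value that a gate has iff all its predecessors have it (for conjunctions and
disjunctions). -/
def polarity (g : Gate) : Bool := decide (g.tag = 2)

/-- Gates of fan-in more than two. -/
def isLarge (g : Gate) : Bool := decide (2 < g.preds.length)

/-- The value of a gate, given the set of true variables and the values of all gates. -/
def valueFun (S : Finset ℕ) (v : ℕ → Bool) : Gate → Bool
  | input i => decide (i ∈ S)
  | neg j => !(v j)
  | conj l => l.all v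
  | disj l => l.any v

theorem preds_eq_nil_of_tag {g : Gate} (h : g.tag = 0) : g.preds = [] := by
  cases g <;> simp_all [tag, preds]

theorem preds_eq_singleton {g : Gate} (h : g.tag = 1) : ∃ c, g = neg c ∧ g.preds = [c] := by
  cases g <;> simp_all [tag, preds]

theorem valueFun_of_tag_zero {g : Gate} (h : g.tag = 0) (S : Finset ℕ) (v : ℕ → Bool) :
    g.valueFun S v = decide (g.var ∈ S) := by
  cases g with
  | input i => rfl
  | _ => simp [tag] at h

/-- Lets conjunctions and disjunctions be treated alike: the value `polarity` is a universal
statement about the predecessors, the other value an existential one. -/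
theorem valueFun_eq_polarity {g : Gate} (h0 : g.tag ≠ 0) (h1 : g.tag ≠ 1) (S : Finset ℕ)
    (v : ℕ → Bool) : g.valueFun S v = g.polarity ↔ ∀ c ∈ g.preds, v c = g.polarity := by
  cases g <;> simp_all [tag, preds, valueFun, polarity]

theorem tag_of_isLarge {g : Gate} (h : g.isLarge = true) : g.tag ≠ 0 ∧ g.tag ≠ 1 := by
  cases g <;> simp_all [tag, preds, isLarge]

end Gate

/-- The gate at position `j`. -/
def gateAt (gs : List Gate) (j : ℕ) : Gate := gs.getD j (Gate.input 0)

theorem gateAt_eq {gs : List Gate} {j : ℕ} (h : j < gs.length) : gateAt gs j = gs[j] := by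
  rw [gateAt, List.getD_eq_getElem]

/-- Tests that the depth of a gate is at most the first argument, and that its weft is at most
one (if the flag is set) or zero (otherwise). -/
def shallow (gs : List Gate) : ℕ → Bool → ℕ → Bool
  | 0, _, j => decide ((gateAt gs j).tag = 0)
  | f + 1, b, j =>
    if (gateAt gs j).isLarge then b && (gateAt gs j).preds.all fun c => shallow gs f false c
    else (gateAt gs j).preds.all fun c => shallow gs f b c

theorem shallow_succ {gs : List Gate} {f : ℕ} {b : Bool} {j : ℕ} (h : shallow gs f b j = true) :
    shallow gs (f + 1) b j = true := by
  induction f generalizing b j with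
  | zero =>
    simp only [shallow, decide_eq_true_eq] at h
    simp [shallow, Gate.preds_eq_nil_of_tag h, Gate.isLarge]
  | succ f ih =>
    rw [shallow] at h ⊢
    split at h
    · simp only [Bool.and_eq_true, List.all_eq_true] at h
      rw [if_pos ‹_›, Bool.and_eq_true, List.all_eq_true]
      exact ⟨h.1, fun c hc => ih (h.2 c hc)⟩
    · simp only [List.all_eq_true] at h
      rw [if_neg ‹_›, List.all_eq_true]
      exact fun c hc => ih (h c hc)

theorem shallow_mono {gs : List Gate} {f d : ℕ} {b : Bool} {j : ℕ} (hfd : f ≤ d)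
    (h : shallow gs f b j = true) : shallow gs d b j = true := by
  induction hfd with
  | refl => exact h
  | step _ ih => exact shallow_succ ih

theorem foldr_max_le {l : List ℕ} {m : ℕ} : l.foldr max 0 ≤ m ↔ ∀ a ∈ l, a ≤ m := by
  induction l with
  | nil => simp
  | cons a l ih => simp [ih]

theorem Gate.depth_le_succ (ds : List ℕ) (g : Gate) (f : ℕ) :
    g.depth ds ≤ f + 1 ↔ ∀ c ∈ g.preds, ds.getD c 0 ≤ f := by
  cases g <;> simp [Gate.depth, Gate.preds, add_comm 1, foldr_max_le]

theorem Gate.depth_le_zero (ds : List ℕ) (g : Gate) : g.depth ds ≤ 0 ↔ g.tag = 0 := by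
  cases g <;> simp [Gate.depth, Gate.tag]

theorem Circuit.WellFormed.preds_lt {C : Circuit} (hC : C.WellFormed) {j : ℕ}
    (hj : j < C.gates.length) : ∀ c ∈ (gateAt C.gates j).preds, c < j := by
  rw [gateAt_eq hj]; exact (hC.2 j hj).1

/-- Passing a large gate uses up the one unit of weft, so the flag drops to `false` below it.
Well-formedness ensures that the entries read by the sweep are final ones. -/
theorem Circuit.WellFormed.shallow_iff {C : Circuit} (hC : C.WellFormed) (f : ℕ) (b : Bool)
    (j : ℕ) (hj : j < C.gates.length) :
    shallow C.gates f b j = true ↔ (C.sweep Gate.depth).getD j 0 ≤ f ∧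
      (C.sweep Gate.weft).getD j 0 ≤ b.toNat := by
  have hp := hC.preds_lt hj
  rw [gateAt_eq hj] at hp
  rw [C.sweep_getD _ _ j hj, C.sweep_getD _ _ j hj]
  induction f generalizing b j with
  | zero =>
    rw [shallow, decide_eq_true_iff, gateAt_eq hj, Gate.depth_le_zero]
    refine ⟨fun h => ⟨h, ?_⟩, fun h => h.1⟩
    simp [Gate.weft, Gate.preds_eq_nil_of_tag h]
  | succ f ih =>
    rw [shallow, gateAt_eq hj, Gate.depth_le_succ]
    have ih' (b : Bool) : (∀ c ∈ C.gates[j].preds, shallow C.gates f b c = true) ↔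
        (∀ c ∈ C.gates[j].preds, ((C.sweep Gate.depth).take j).getD c 0 ≤ f) ∧
        (C.gates[j].preds.map fun c => ((C.sweep Gate.weft).take j).getD c 0).foldr max 0 ≤
          b.toNat := by
      rw [foldr_max_le, List.forall_mem_map, ← forall₂_and]
      refine forall₂_congr fun c hc => ?_
      have hcl : c < C.gates.length := (hp c hc).trans hj
      have := hC.preds_lt hcl
      rw [gateAt_eq hcl] at this
      refine (ih b c hcl this).trans ?_
      rw [Circuit.take_getD _ _ (hp c hc), Circuit.take_getD _ _ (hp c hc),
        C.sweep_getD _ _ c hcl, C.sweep_getD _ _ c hcl]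
    rw [Gate.weft, Gate.isLarge]
    by_cases hl : 2 < C.gates[j].preds.length
    · simp only [hl, decide_true, if_true, Bool.and_eq_true, List.all_eq_true, ih']
      cases b <;> simp
    · simp only [hl, decide_false, if_false, List.all_eq_true, ih', Bool.false_eq_true, zero_add]

theorem Circuit.WellFormed.shallow_output_iff {C : Circuit} (hC : C.WellFormed) (d : ℕ) :
    shallow C.gates d true (C.gates.length - 1) = true ↔ C.depth ≤ d ∧ C.weft ≤ 1 := by
  have := List.length_pos_of_ne_nil hC.1
  rw [hC.shallow_iff _ _ _ (by omega), Circuit.depth, Circuit.weft, C.sweep_getLastD,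
    C.sweep_getLastD]
  rfl

/-- The values of all gates of a circuit. -/
def Circuit.values (C : Circuit) (S : Finset ℕ) (j : ℕ) : Bool :=
  (C.sweep (Gate.value S)).getD j false

theorem Circuit.eval_eq_values (C : Circuit) (S : Finset ℕ) :
    C.eval S = C.values S (C.gates.length - 1) := C.sweep_getLastD _ _

theorem Circuit.WellFormed.values_eq {C : Circuit} (hC : C.WellFormed) (S : Finset ℕ) {j : ℕ}
    (hj : j < C.gates.length) :
    C.values S j = (gateAt C.gates j).valueFun S (C.values S) := by
  have hp := hC.preds_lt hj
  rw [gateAt_eq hj] at hp ⊢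
  rw [Circuit.values, C.sweep_getD _ _ j hj]
  have key : ∀ c ∈ C.gates[j].preds,
      ((C.sweep (Gate.value S)).take j).getD c false = C.values S c :=
    fun c hc => Circuit.take_getD _ _ (hp c hc)
  generalize C.gates[j] = g at *
  cases g with
  | input i => rfl
  | neg c => simp only [Gate.value, Gate.valueFun, key c (by simp [Gate.preds])]
  | conj l =>
    simp only [Gate.value, Gate.valueFun]
    rw [Bool.eq_iff_iff, List.all_eq_true, List.all_eq_true]
    exact forall₂_congr fun c hc => by rw [key c hc]
  | disj l =>
    simp only [Gate.value, Gate.valueFun]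
    rw [Bool.eq_iff_iff, List.any_eq_true, List.any_eq_true]
    exact exists_congr fun c => and_congr_right fun hc => by rw [key c hc]

/-! ### Evaluating a circuit from partial information on its input -/

/-- Tests whether a window, a list of pairs `(p, i + 1)` that say that `i` is the `p`-th true
variable, forces a variable to be true or false. -/
def windowForces (w : List (ℕ × ℕ)) (i : ℕ) (b : Bool) : Bool :=
  if b then w.any fun q => decide (q.2 = i + 1)
  else w.any fun q => w.any fun r =>
    decide (r.1 = q.1 + 1) && (decide (q.2 < i + 1) && decide (i + 1 < r.2))

/-- The large gates of weft one whose values may be assumed. -/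
def assumable (gs : List Gate) (d j : ℕ) : Bool :=
  (gateAt gs j).isLarge && (gateAt gs j).preds.all fun c => shallow gs d false c

/-- Tests whether a window, and the assumption that the gates in `g` have the values given by
their polarities, force a gate to have a given value. -/
def forces (gs : List Gate) (d : ℕ) (w : List (ℕ × ℕ)) (g : List ℕ) : ℕ → ℕ → Bool → Bool
  | 0, j, b => decide ((gateAt gs j).tag = 0) && windowForces w (gateAt gs j).var b
  | f + 1, j, b =>
    (decide (j ∈ g) && assumable gs d j && decide (b = (gateAt gs j).polarity)) ||
    (if (gateAt gs j).tag = 0 then windowForces w (gateAt gs j).var b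
    else if (gateAt gs j).tag = 1 then (gateAt gs j).preds.any fun c => forces gs d w g f c (!b)
    else if b = (gateAt gs j).polarity then
      (gateAt gs j).preds.all fun c => forces gs d w g f c b
    else (gateAt gs j).preds.any fun c => forces gs d w g f c b)

/-- Tests whether a window refutes the assumption on a gate. -/
def refutes (gs : List Gate) (d : ℕ) (w : List (ℕ × ℕ)) (j : ℕ) : Bool :=
  assumable gs d j &&
    (gateAt gs j).preds.any fun c => forces gs d w [] d c (!(gateAt gs j).polarity)

theorem windowForces_mono {w w' : List (ℕ × ℕ)} (h : w ⊆ w') {i : ℕ} {b : Bool}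
    (hw : windowForces w i b = true) : windowForces w' i b = true := by
  unfold windowForces at *
  cases b
  · simp only [Bool.false_eq_true, if_false, List.any_eq_true] at *
    obtain ⟨q, hq, r, hr, hqr⟩ := hw
    exact ⟨q, h hq, r, h hr, hqr⟩
  · simp only [if_true, List.any_eq_true] at *
    obtain ⟨q, hq, hqr⟩ := hw
    exact ⟨q, h hq, hqr⟩

theorem forces_mono {gs : List Gate} {d : ℕ} {w w' : List (ℕ × ℕ)} {g g' : List ℕ}
    (hw : w ⊆ w') (hg : g ⊆ g') {f j : ℕ} {b : Bool} (h : forces gs d w g f j b = true) :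
    forces gs d w' g' f j b = true := by
  induction f generalizing j b with
  | zero =>
    simp only [forces, Bool.and_eq_true] at *
    exact ⟨h.1, windowForces_mono hw h.2⟩
  | succ f ih =>
    rw [forces, Bool.or_eq_true] at h ⊢
    refine h.imp (fun h => ?_) fun h => ?_
    · simp only [Bool.and_eq_true, decide_eq_true_eq] at *
      exact ⟨⟨hg h.1.1, h.1.2⟩, h.2⟩
    · split_ifs at h ⊢ with h1 h2 h3
      · exact windowForces_mono hw h
      · obtain ⟨c, hc, h⟩ := List.any_eq_true.1 h
        exact List.any_eq_true.2 ⟨c, hc, ih h⟩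
      · exact List.all_eq_true.2 fun c hc => ih (List.all_eq_true.1 h c hc)
      · obtain ⟨c, hc, h⟩ := List.any_eq_true.1 h
        exact List.any_eq_true.2 ⟨c, hc, ih h⟩

/-! ### Soundness and completeness of forcing and refuting -/

section

variable {gs : List Gate} {d n : ℕ} {S : Finset ℕ} {v : ℕ → Bool}

theorem forces_sound
    (hp : ∀ j < gs.length, ∀ c ∈ (gateAt gs j).preds, c < gs.length)
    (hv : ∀ j < gs.length, v j = (gateAt gs j).valueFun S v)
    (hn : ∀ j < gs.length, (gateAt gs j).tag = 0 → (gateAt gs j).var < n)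
    {w : List (ℕ × ℕ)} {g : List ℕ}
    (hw : ∀ i < n, ∀ b, windowForces w i b = true → decide (i ∈ S) = b)
    (hg : ∀ j ∈ g, assumable gs d j = true → v j = (gateAt gs j).polarity)
    {f j : ℕ} {b : Bool} (hj : j < gs.length) (h : forces gs d w g f j b = true) : v j = b := by
  induction f generalizing j b with
  | zero =>
    simp only [forces, Bool.and_eq_true, decide_eq_true_eq] at h
    rw [hv j hj, Gate.valueFun_of_tag_zero h.1]
    exact hw _ (hn j hj h.1) _ h.2
  | succ f ih =>
    rw [forces, Bool.or_eq_true] at h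
    rcases h with h | h
    · simp only [Bool.and_eq_true, decide_eq_true_eq] at h
      rw [h.2, hg j h.1.1 h.1.2]
    · split_ifs at h with h1 h2 h3
      · rw [hv j hj, Gate.valueFun_of_tag_zero h1]
        exact hw _ (hn j hj h1) _ h
      · obtain ⟨c, hc, h⟩ := List.any_eq_true.1 h
        have hvc := ih (hp j hj c hc) h
        obtain ⟨c', h3, h4⟩ := Gate.preds_eq_singleton h2
        rw [h4, List.mem_singleton] at hc
        rw [hv j hj, h3, Gate.valueFun, ← hc, hvc, Bool.not_not]
      · rw [hv j hj, h3, Gate.valueFun_eq_polarity h1 h2, ← h3]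
        exact fun c hc => ih (hp j hj c hc) (List.all_eq_true.1 h c hc)
      · obtain ⟨c, hc, h⟩ := List.any_eq_true.1 h
        have hvc := ih (hp j hj c hc) h
        -- One predecessor with the value `b`, which is not the polarity, breaks the universal
        -- condition; as there are only two truth values, the gate has the value `b`.
        have : v j ≠ (gateAt gs j).polarity := by
          rw [hv j hj, Ne, Gate.valueFun_eq_polarity h1 h2]
          exact fun h' => h3 (hvc.symm.trans (h' c hc))
        cases hb : v j <;> cases b <;> cases hq : (gateAt gs j).polarity <;> simp_all

/-- A literal costs two pairs, and only a small gate whose value is its polarity needs two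
predecessors, so the bounds double once per level. A large gate with that value is put into `g`. The
flag `b = false` excludes large gates, which is why `g` is then empty. `P` is kept abstract; it will
say that a pair belongs to the enumeration of the assignment. -/
theorem forces_complete
    (hp : ∀ j < gs.length, ∀ c ∈ (gateAt gs j).preds, c < gs.length)
    (hv : ∀ j < gs.length, v j = (gateAt gs j).valueFun S v)
    (hn : ∀ j < gs.length, (gateAt gs j).tag = 0 → (gateAt gs j).var < n)
    {P : ℕ × ℕ → Prop}
    (hw : ∀ i < n, ∃ w : List (ℕ × ℕ), w.length ≤ 2 ∧ (∀ q ∈ w, P q) ∧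
      windowForces w i (decide (i ∈ S)) = true)
    {f j : ℕ} {b : Bool} (hfd : f ≤ d) (hj : j < gs.length) (h : shallow gs f b j = true) :
    ∃ (w : List (ℕ × ℕ)) (g : List ℕ), w.length ≤ 2 ^ (f + 1) ∧ g.length ≤ 2 ^ f ∧
      (∀ q ∈ w, P q) ∧
      (∀ l ∈ g, l < gs.length ∧ assumable gs d l = true ∧ v l = (gateAt gs l).polarity) ∧
      (b = false → g = []) ∧ forces gs d w g f j (v j) = true := by
  induction f generalizing j b with
  | zero =>
    simp only [shallow, decide_eq_true_eq] at h
    obtain ⟨w, h1, h2, h3⟩ := hw _ (hn j hj h)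
    refine ⟨w, [], by simpa using h1, by simp, h2, by simp, fun _ => rfl, ?_⟩
    simp only [forces, h, decide_true, Bool.true_and]
    rw [hv j hj, Gate.valueFun_of_tag_zero h]
    exact h3
  | succ f ih =>
    have hpow : 2 ^ (f + 1 + 1) = 2 ^ (f + 1) + 2 ^ (f + 1) := by ring
    have hpow' : 2 ^ (f + 1) = 2 ^ f + 2 ^ f := by ring
    have hpos : 0 < 2 ^ f := by positivity
    -- `b'` is the weft flag that remains for the predecessors.
    obtain ⟨b', hb', hc⟩ : ∃ b', (b = false → b' = false) ∧
        ∀ c ∈ (gateAt gs j).preds, shallow gs f b' c = true := by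
      rw [shallow] at h
      split_ifs at h with hl
      · exact ⟨false, fun _ => rfl, List.all_eq_true.1 (Bool.and_eq_true_iff.1 h).2⟩
      · exact ⟨b, fun h => h, List.all_eq_true.1 h⟩
    -- one predecessor is enough
    have one : ∀ c ∈ (gateAt gs j).preds, (∀ w g, forces gs d w g f c (v c) = true →
        forces gs d w g (f + 1) j (v j) = true) →
        ∃ (w : List (ℕ × ℕ)) (g : List ℕ), w.length ≤ 2 ^ (f + 1 + 1) ∧ g.length ≤ 2 ^ (f + 1) ∧
        (∀ q ∈ w, P q) ∧
        (∀ l ∈ g, l < gs.length ∧ assumable gs d l = true ∧ v l = (gateAt gs l).polarity) ∧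
        (b = false → g = []) ∧ forces gs d w g (f + 1) j (v j) = true := by
      intro c hcm himp
      obtain ⟨w, g, h1, h2, h3, h4, h5, h6⟩ := ih (by omega) (hp j hj c hcm) (hc c hcm)
      exact ⟨w, g, by omega, by omega, h3, h4, fun h => h5 (hb' h), himp w g h6⟩
    by_cases h0 : (gateAt gs j).tag = 0
    · obtain ⟨w, h1, h2, h3⟩ := hw _ (hn j hj h0)
      refine ⟨w, [], by omega, by simp, h2, by simp, fun _ => rfl, ?_⟩
      rw [forces, if_pos h0, Bool.or_eq_true, hv j hj, Gate.valueFun_of_tag_zero h0]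
      exact Or.inr h3
    by_cases h1 : (gateAt gs j).tag = 1
    · obtain ⟨c, h3, h4⟩ := Gate.preds_eq_singleton h1
      refine one c (by simp [h4]) fun w g hf => ?_
      rw [forces, if_neg h0, if_pos h1, Bool.or_eq_true]
      refine Or.inr (List.any_eq_true.2 ⟨c, by simp [h4], ?_⟩)
      rw [hv j hj, h3, Gate.valueFun, Bool.not_not]
      exact hf
    by_cases h2 : v j = (gateAt gs j).polarity
    · by_cases hl : (gateAt gs j).isLarge = true
      · rw [shallow, if_pos hl, Bool.and_eq_true, List.all_eq_true] at h
        have ha : assumable gs d j = true := by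
          rw [assumable, hl, Bool.true_and, List.all_eq_true]
          exact fun c hcm => shallow_mono (by omega) (h.2 c hcm)
        refine ⟨[], [j], by simp, by rw [List.length_singleton]; omega, by simp,
          by simp [ha, hj, h2], fun hb => ?_, ?_⟩
        · simp [hb] at h
        · rw [forces, h2]
          simp [ha]
      · have hlen : (gateAt gs j).preds.length ≤ 2 := by simpa [Gate.isLarge] using hl
        have hall := (Gate.valueFun_eq_polarity h0 h1 S v).1 ((hv j hj).symm.trans h2)
        obtain ⟨w, g, k1, k2, k3, k4, k5, k6⟩ : ∃ (w : List (ℕ × ℕ)) (g : List ℕ),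
            w.length ≤ 2 ^ (f + 1 + 1) ∧ g.length ≤ 2 ^ (f + 1) ∧ (∀ q ∈ w, P q) ∧
            (∀ l ∈ g, l < gs.length ∧ assumable gs d l = true ∧ v l = (gateAt gs l).polarity) ∧
            (b = false → g = []) ∧
            ∀ c ∈ (gateAt gs j).preds, forces gs d w g f c (v c) = true := by
          rcases hpr : (gateAt gs j).preds with _ | ⟨c, _ | ⟨c', _ | ⟨c'', l⟩⟩⟩
          · exact ⟨[], [], by simp, by simp, by simp, by simp, fun _ => rfl, by simp⟩
          · obtain ⟨w, g, h1, h2, h3, h4, h5, h6⟩ :=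
              ih (j := c) (by omega) (hp j hj c (by simp [hpr])) (hc c (by simp [hpr]))
            exact ⟨w, g, by omega, by omega, h3, h4, fun h => h5 (hb' h), by simpa using h6⟩
          · obtain ⟨w, g, h1, h2, h3, h4, h5, h6⟩ :=
              ih (j := c) (by omega) (hp j hj c (by simp [hpr])) (hc c (by simp [hpr]))
            obtain ⟨w', g', h1', h2', h3', h4', h5', h6'⟩ :=
              ih (j := c') (by omega) (hp j hj c' (by simp [hpr])) (hc c' (by simp [hpr]))
            refine ⟨w ++ w', g ++ g', by rw [List.length_append]; omega,
              by rw [List.length_append]; omega, fun q hq => ?_, fun q hq => ?_,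
              fun hb => by rw [h5 (hb' hb), h5' (hb' hb)]; rfl, fun q hq => ?_⟩
            · exact (List.mem_append.1 hq).elim (h3 q) (h3' q)
            · exact (List.mem_append.1 hq).elim (h4 q) (h4' q)
            · simp only [List.mem_cons, List.not_mem_nil, or_false] at hq
              rcases hq with rfl | rfl
              · exact forces_mono (by simp) (by simp) h6
              · exact forces_mono (by simp) (by simp) h6'
          · rw [hpr] at hlen
            simp at hlen
        refine ⟨w, g, k1, k2, k3, k4, k5, ?_⟩
        rw [forces, if_neg h0, if_neg h1, if_pos h2, Bool.or_eq_true]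
        refine Or.inr (List.all_eq_true.2 fun c hcm => ?_)
        rw [h2, ← hall c hcm]
        exact k6 c hcm
    -- The value differs from the polarity, so a single predecessor witnesses it, whatever the
    -- fan-in.
    · have h3 : ¬∀ c ∈ (gateAt gs j).preds, v c = (gateAt gs j).polarity := by
        rwa [← Gate.valueFun_eq_polarity h0 h1 S v, ← hv j hj]
      push Not at h3
      obtain ⟨c, hcm, hne⟩ := h3
      refine one c hcm fun w g hf => ?_
      rw [forces, if_neg h0, if_neg h1, if_neg h2, Bool.or_eq_true]
      refine Or.inr (List.any_eq_true.2 ⟨c, hcm, ?_⟩)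
      have : v j = v c := by
        cases hb : v j <;> cases hb' : v c <;> cases hq : (gateAt gs j).polarity <;> simp_all
      rwa [this]

theorem refutes_sound
    (hp : ∀ j < gs.length, ∀ c ∈ (gateAt gs j).preds, c < gs.length)
    (hv : ∀ j < gs.length, v j = (gateAt gs j).valueFun S v)
    (hn : ∀ j < gs.length, (gateAt gs j).tag = 0 → (gateAt gs j).var < n)
    {w : List (ℕ × ℕ)}
    (hw : ∀ i < n, ∀ b, windowForces w i b = true → decide (i ∈ S) = b)
    {j : ℕ} (hj : j < gs.length) (hvj : v j = (gateAt gs j).polarity) :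
    refutes gs d w j = false := by
  by_contra h
  rw [Bool.not_eq_false, refutes, Bool.and_eq_true, List.any_eq_true] at h
  obtain ⟨ha, c, hc, h⟩ := h
  have hl := (Bool.and_eq_true_iff.1 ha).1
  have h1 := forces_sound hp hv hn hw (by simp) (hp j hj c hc) h
  rw [hv j hj, Gate.valueFun_eq_polarity (Gate.tag_of_isLarge hl).1
    (Gate.tag_of_isLarge hl).2] at hvj
  rw [hvj c hc] at h1
  simp at h1

/-- If the assumption failed, some predecessor would have the wrong value. Below an assumable gate
there is no large gate, so that value is forced by a short window without further assumptions, and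
this window refutes the assumption. -/
theorem refutes_complete
    (hp : ∀ j < gs.length, ∀ c ∈ (gateAt gs j).preds, c < gs.length)
    (hv : ∀ j < gs.length, v j = (gateAt gs j).valueFun S v)
    (hn : ∀ j < gs.length, (gateAt gs j).tag = 0 → (gateAt gs j).var < n)
    {P : ℕ × ℕ → Prop}
    (hw : ∀ i < n, ∃ w : List (ℕ × ℕ), w.length ≤ 2 ∧ (∀ q ∈ w, P q) ∧
      windowForces w i (decide (i ∈ S)) = true)
    {j : ℕ} (hj : j < gs.length) (ha : assumable gs d j = true)
    (h : ∀ w : List (ℕ × ℕ), w.length ≤ 2 ^ (d + 1) → (∀ q ∈ w, P q) →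
      refutes gs d w j = false) : v j = (gateAt gs j).polarity := by
  have ha' := Bool.and_eq_true_iff.1 ha
  rw [hv j hj, Gate.valueFun_eq_polarity (Gate.tag_of_isLarge ha'.1).1
    (Gate.tag_of_isLarge ha'.1).2]
  intro c hc
  by_contra hne
  obtain ⟨w, g, h1, -, h3, -, h5, h6⟩ := forces_complete hp hv hn hw le_rfl (hp j hj c hc)
    (List.all_eq_true.1 ha'.2 c hc)
  rw [h5 rfl] at h6
  have := h w h1 h3
  rw [refutes, ha, Bool.true_and, List.any_eq_false] at this
  refine this c hc ?_
  convert h6 using 1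
  cases hb : v c <;> cases hq : (gateAt gs j).polarity <;> simp_all

end

/-! ### Weighted satisfiability as a choice of consistent windows -/

/-- `x` lists the true variables in increasing order, shifted by one and with sentinels. -/
structure IsEnumeration (n k : ℕ) (S : Finset ℕ) (x : ℕ → ℕ) : Prop where
  mono : ∀ p q, p < q → q ≤ k + 1 → x p < x q
  zero : x 0 = 0
  last : x (k + 1) = n + 1
  mem : ∀ i < n, i ∈ S ↔ ∃ p ≤ k + 1, x p = i + 1

theorem exists_isEnumeration {n k : ℕ} {S : Finset ℕ} (hS : S ⊆ Finset.range n)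
    (hk : S.card = k) : ∃ x, IsEnumeration n k S x := by
  -- The increasing enumeration of `S`, moved to the positions `1, …, k`; the sentinels occupy `0`
  -- and `k + 1`.
  let e := S.orderEmbOfFin hk
  have he (i : Fin k) : e i < n := Finset.mem_range.1 (hS (S.orderEmbOfFin_mem hk i))
  have hx (p : ℕ) (hp : p < k) :
      (if p + 1 = 0 then 0 else if h : p + 1 - 1 < k then e ⟨p + 1 - 1, h⟩ + 1 else n + 1) =
        e ⟨p, hp⟩ + 1 := by simp [hp]
  refine ⟨fun p => if p = 0 then 0 else if h : p - 1 < k then e ⟨p - 1, h⟩ + 1 else n + 1,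
    fun p q hpq hq => ?_, by simp, by simp, fun i hi => ?_⟩
  · obtain ⟨q, rfl⟩ := Nat.exists_eq_add_one_of_ne_zero (by omega : q ≠ 0)
    rcases p with _ | p
    · simp only [if_true, Nat.add_one_ne_zero, if_false]
      split <;> omega
    · rw [hx p (by omega)]
      simp only [Nat.add_one_ne_zero, if_false, add_tsub_cancel_right]
      split
      · have : e ⟨p, by omega⟩ < e ⟨q, ‹_›⟩ := e.strictMono (Fin.mk_lt_mk.2 (by omega))
        omega
      · have := he ⟨p, by omega⟩
        omega
  · constructor
    · intro h
      obtain ⟨j, hj⟩ : i ∈ Set.range e := by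
        rw [Finset.range_orderEmbOfFin]; exact h
      refine ⟨j + 1, by omega, ?_⟩
      rw [hx j j.2]
      simpa using hj
    · rintro ⟨p, hp, h⟩
      split_ifs at h with h1 h2
      · have : e ⟨p - 1, h2⟩ = i := by omega
        rw [← this]
        exact S.orderEmbOfFin_mem hk _
      · omega

/-- Strict monotonicity makes the `k` inner entries distinct and keeps them between the sentinels,
so the weight is exactly `k`. -/
theorem exists_set_of_enumeration {n k : ℕ} {x : ℕ → ℕ}
    (mono : ∀ p q, p < q → q ≤ k + 1 → x p < x q) (zero : x 0 = 0) (last : x (k + 1) = n + 1) :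
    ∃ S ⊆ Finset.range n, S.card = k ∧ IsEnumeration n k S x := by
  have hpos (p : ℕ) (hp : p < k) : 0 < x (p + 1) ∧ x (p + 1) < n + 1 := by
    have h1 := mono 0 (p + 1) (by omega) (by omega)
    have h2 := mono (p + 1) (k + 1) (by omega) le_rfl
    omega
  refine ⟨(Finset.range k).image fun p => x (p + 1) - 1, ?_, ?_, mono, zero, last, fun i hi => ?_⟩
  · intro i hi
    obtain ⟨p, hp, rfl⟩ := Finset.mem_image.1 hi
    have := hpos p (Finset.mem_range.1 hp)
    exact Finset.mem_range.2 (by omega)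
  · rw [Finset.card_image_of_injOn, Finset.card_range]
    intro p hp q hq h
    have hp := Finset.mem_range.1 hp
    have hq := Finset.mem_range.1 hq
    have h1 := hpos p hp
    have h2 := hpos q hq
    dsimp only at h
    rcases lt_trichotomy p q with hlt | rfl | hlt
    · have := mono (p + 1) (q + 1) (by omega) (by omega); omega
    · rfl
    · have := mono (q + 1) (p + 1) (by omega) (by omega); omega
  · rw [Finset.mem_image]
    constructor
    · rintro ⟨p, hp, h⟩
      have hp := Finset.mem_range.1 hp
      have := hpos p hp
      exact ⟨p + 1, by omega, by omega⟩
    · rintro ⟨p, hp, h⟩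
      have h0 : p ≠ 0 := by rintro rfl; omega
      have h1 : p ≠ k + 1 := by rintro rfl; omega
      exact ⟨p - 1, Finset.mem_range.2 (by omega), by rw [Nat.sub_add_cancel (by omega)]; omega⟩

/-! ### Windows of an enumeration -/

section

variable {n k : ℕ} {S : Finset ℕ} {x : ℕ → ℕ}

theorem IsEnumeration.le_iff (hx : IsEnumeration n k S x) {p q : ℕ} (hp : p ≤ k + 1)
    (hq : q ≤ k + 1) : x p < x q ↔ p < q := by
  refine ⟨fun h => ?_, fun h => hx.mono p q h hq⟩
  by_contra hle
  rcases (not_lt.1 hle).eq_or_lt with rfl | hlt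
  · omega
  · have := hx.mono q p hlt hp; omega

theorem IsEnumeration.windowForces_sound (hx : IsEnumeration n k S x) {w : List (ℕ × ℕ)}
    (hw : ∀ q ∈ w, q.1 ≤ k + 1 ∧ x q.1 = q.2) (i : ℕ) (hi : i < n) (b : Bool)
    (h : windowForces w i b = true) : decide (i ∈ S) = b := by
  unfold windowForces at h
  cases b
  · simp only [Bool.false_eq_true, if_false, List.any_eq_true, Bool.and_eq_true,
      decide_eq_true_eq] at h
    obtain ⟨q, hq, r, hr, h1, h2, h3⟩ := h
    rw [decide_eq_false_iff_not, hx.mem i hi]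
    rintro ⟨p, hp, hpi⟩
    rw [← hpi, ← (hw q hq).2, hx.le_iff (hw q hq).1 hp] at h2
    rw [← hpi, ← (hw r hr).2, hx.le_iff hp (hw r hr).1] at h3
    omega
  · simp only [if_true, List.any_eq_true, decide_eq_true_eq] at h
    obtain ⟨q, hq, h⟩ := h
    rw [decide_eq_true_iff, hx.mem i hi]
    exact ⟨q.1, (hw q hq).1, (hw q hq).2.trans h⟩

theorem IsEnumeration.windowForces_complete (hx : IsEnumeration n k S x) (i : ℕ) (hi : i < n) :
    ∃ w : List (ℕ × ℕ), w.length ≤ 2 ∧ (∀ q ∈ w, q.1 ≤ k + 1 ∧ x q.1 = q.2) ∧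
      windowForces w i (decide (i ∈ S)) = true := by
  by_cases h : i ∈ S
  · obtain ⟨p, hp, hpi⟩ := (hx.mem i hi).1 h
    exact ⟨[(p, x p)], by simp, by simp [hp], by simp [windowForces, h, hpi]⟩
  · have hne : ∀ p ≤ k + 1, x p ≠ i + 1 := fun p hp hpi => h ((hx.mem i hi).2 ⟨p, hp, hpi⟩)
    have hex : ∃ p, i + 1 < x p := ⟨k + 1, by rw [hx.last]; omega⟩
    classical
    -- The first entry beyond the variable and its predecessor enclose the variable. The sentinels
    -- guarantee that both exist.
    obtain ⟨p, hp, hmin⟩ : ∃ p, i + 1 < x p ∧ ∀ q < p, ¬i + 1 < x q :=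
      ⟨Nat.find hex, Nat.find_spec hex, fun q hq => Nat.find_min hex hq⟩
    have hple : p ≤ k + 1 := by
      by_contra hlt
      exact hmin (k + 1) (by omega) (by rw [hx.last]; omega)
    have h0 : p ≠ 0 := by rintro rfl; rw [hx.zero] at hp; omega
    obtain ⟨q, rfl⟩ := Nat.exists_eq_add_one_of_ne_zero h0
    have h1 := hmin q (by omega)
    have h2 := hne q (by omega)
    refine ⟨[(q, x q), (q + 1, x (q + 1))], by simp, ?_, ?_⟩
    · simp only [List.mem_cons, List.not_mem_nil, or_false]
      rintro r (rfl | rfl) <;> exact ⟨by dsimp only; omega, rfl⟩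
    · have h3 : x q ≤ i := by omega
      simp [windowForces, h, h3, hp]

end

/-- All lists of length at most `m` with entries from `l`. -/
def listsLE {α : Type} (l : List α) : ℕ → List (List α)
  | 0 => [[]]
  | m + 1 => [] :: l.flatMap fun a => (listsLE l m).map fun t => a :: t

theorem mem_listsLE {α : Type} {l : List α} {m : ℕ} {t : List α} :
    t ∈ listsLE l m ↔ t.length ≤ m ∧ ∀ a ∈ t, a ∈ l := by
  induction m generalizing t with
  | zero => cases t <;> simp [listsLE]
  | succ m ih =>
    cases t with
    | nil => simp [listsLE]
    | cons a t => simp [listsLE, ih]; tauto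

theorem length_listsLE_le {α : Type} (l : List α) (m : ℕ) :
    (listsLE l m).length ≤ (l.length + 1) ^ m := by
  induction m with
  | zero => simp [listsLE]
  | succ m ih =>
    have h1 : (listsLE l (m + 1)).length = l.length * (listsLE l m).length + 1 := by
      simp [listsLE, List.length_flatMap]
    have h2 : 0 < (l.length + 1) ^ m := by positivity
    rw [h1, pow_succ]
    nlinarith

/-- Tests that two windows may come from the same enumeration. -/
def consistent (w w' : List (ℕ × ℕ)) : Bool :=
  w.all fun q => w'.all fun r =>
    decide (decide (q.1 < r.1) = decide (q.2 < r.2)) &&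
      decide (decide (r.1 < q.1) = decide (r.2 < q.2))

theorem consistent_iff {w w' : List (ℕ × ℕ)} : consistent w w' = true ↔
    ∀ q ∈ w, ∀ r ∈ w', (q.1 < r.1 ↔ q.2 < r.2) ∧ (r.1 < q.1 ↔ r.2 < q.2) := by
  simp only [consistent, List.all_eq_true, Bool.and_eq_true, decide_eq_true_eq, decide_eq_decide]

/-- A window, gates with assumed values, and the positions of the window that is claimed to force
the output. -/
abbrev Candidate : Type := List (ℕ × ℕ) × List ℕ × List ℕ

/-- The positions that the window of a candidate speaks about. -/
def Candidate.block (c : Candidate) : List ℕ := c.1.map fun q => q.1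

/-- Tests that two candidates may be chosen together. -/
def Candidate.compatible (c c' : Candidate) : Bool :=
  consistent c.1 c'.1 && decide (c.2 = c'.2)

/-- Tests that nothing is wrong with a candidate alone. -/
def Candidate.valid (gs : List Gate) (d n k : ℕ) (c : Candidate) : Bool :=
  (consistent ((0, 0) :: (k + 1, n + 1) :: c.1) ((0, 0) :: (k + 1, n + 1) :: c.1) &&
    c.2.1.all fun j => !refutes gs d c.1 j) &&
  (!decide (c.block = c.2.2) || forces gs d c.1 c.2.1 d gs.tail.length true)

/-- The lists of positions for which a candidate has to be chosen. -/
def blocks (d k : ℕ) : List (List ℕ) := listsLE (List.range (k + 2)) (2 ^ (d + 1))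

/-- All candidates. -/
def candidates (gs : List Gate) (d n k : ℕ) : List Candidate :=
  (listsLE (List.range (k + 2) ×ˢ List.range (n + 2)) (2 ^ (d + 1)) ×ˢ
    (listsLE (List.range gs.length) (2 ^ d) ×ˢ blocks d k)).filter
      fun c => Candidate.valid gs d n k c

/-- Needed for the graph of the reduction to have no loops. -/
theorem Candidate.compatible_self {gs : List Gate} {d n k : ℕ} {c : Candidate}
    (h : Candidate.valid gs d n k c = true) : Candidate.compatible c c = true := by
  simp only [valid, Bool.and_eq_true, consistent_iff] at h
  simp only [compatible, decide_true, Bool.and_true, consistent_iff]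
  exact fun q hq r hr => h.1.1 q (by simp [hq]) r (by simp [hr])

theorem map_fst_eq_self {w : List (ℕ × ℕ)} {x : ℕ → ℕ} (h : ∀ q ∈ w, x q.1 = q.2) :
    (w.map fun q => q.1).map (fun p => (p, x p)) = w := by
  induction w with
  | nil => rfl
  | cons q w ih =>
    simp only [List.map_cons, ih fun r hr => h r (by simp [hr]), h q (by simp)]

/-- From an assignment, restrict its enumeration to each block and attach one common certificate.
Conversely, the singleton blocks define an enumeration, compatibility makes every window a part of
it, and the blocks together contain every window that could refute an assumption. -/
theorem Circuit.WellFormed.exists_candidates_iff {C : Circuit} (hC : C.WellFormed) {d : ℕ} (k : ℕ)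
    (hd : shallow C.gates d true (C.gates.length - 1) = true) :
    (∃ S ⊆ Finset.range C.numInputs, S.card = k ∧ C.eval S = true) ↔
      ∃ F : List ℕ → Candidate, ∀ A ∈ blocks d k, F A ∈ candidates C.gates d C.numInputs k ∧
        (F A).block = A ∧ ∀ B ∈ blocks d k, Candidate.compatible (F A) (F B) = true := by
  have hlen := List.length_pos_of_ne_nil hC.1
  have hp : ∀ j < C.gates.length, ∀ c ∈ (gateAt C.gates j).preds, c < C.gates.length :=
    fun j hj c hc => (hC.preds_lt hj c hc).trans hj
  have hn : ∀ j < C.gates.length, (gateAt C.gates j).tag = 0 →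
      (gateAt C.gates j).var < C.numInputs := by
    intro j hj h
    rw [gateAt_eq hj] at h ⊢
    have := (hC.2 j hj).2
    generalize C.gates[j] = g at *
    cases g with
    | input i => exact this i rfl
    | _ => simp [Gate.tag] at h
  have hout : C.gates.tail.length = C.gates.length - 1 := List.length_tail
  have hR : 1 ≤ 2 ^ (d + 1) := Nat.one_le_two_pow
  set n := C.numInputs
  constructor
  · rintro ⟨S, hS, hk, he⟩
    rw [C.eval_eq_values] at he
    obtain ⟨x, hx⟩ := exists_isEnumeration hS hk
    have hv : ∀ j < C.gates.length, C.values S j = (gateAt C.gates j).valueFun S (C.values S) :=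
      fun j hj => hC.values_eq S hj
    obtain ⟨E, g, h1, h2, h3, h4, -, h6⟩ := forces_complete hp hv hn hx.windowForces_complete
      le_rfl (by omega) hd
    rw [he] at h6
    have hEb : (E.map fun q => q.1) ∈ blocks d k := by
      refine mem_listsLE.2 ⟨by simpa using h1, fun a ha => ?_⟩
      obtain ⟨q, hq, rfl⟩ := List.mem_map.1 ha
      exact List.mem_range.2 (by have := (h3 q hq).1; omega)
    -- `g` and the positions of `E` certify the output and are the same for all blocks.
    refine ⟨fun A => (A.map fun p => (p, x p), g, E.map fun q => q.1), fun A hA => ?_⟩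
    have hA' := mem_listsLE.1 hA
    have hAk : ∀ p ∈ A, p ≤ k + 1 := fun p hp => by
      have := List.mem_range.1 (hA'.2 p hp); omega
    have hblock : Candidate.block (A.map fun p => (p, x p), g, E.map fun q => q.1) = A := by
      simp [Candidate.block, Function.comp_def]
    have hgood : ∀ q ∈ (0, 0) :: (k + 1, n + 1) :: A.map fun p => (p, x p),
        q.1 ≤ k + 1 ∧ x q.1 = q.2 := by
      intro q hq
      rcases List.mem_cons.1 hq with rfl | hq
      · exact ⟨by simp, hx.zero⟩
      rcases List.mem_cons.1 hq with rfl | hq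
      · exact ⟨le_rfl, hx.last⟩
      obtain ⟨p, hp, rfl⟩ := List.mem_map.1 hq
      exact ⟨hAk p hp, rfl⟩
    refine ⟨?_, hblock, fun B hB => ?_⟩
    · rw [candidates, List.mem_filter]
      constructor
      · refine List.pair_mem_product.2 ⟨mem_listsLE.2 ⟨by simpa using hA'.1, fun a ha => ?_⟩,
          List.pair_mem_product.2
            ⟨mem_listsLE.2 ⟨h2, fun l hl => List.mem_range.2 (h4 l hl).1⟩, hEb⟩⟩
        obtain ⟨p, hp, rfl⟩ := List.mem_map.1 ha
        have h5 := hAk p hp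
        refine List.pair_mem_product.2 ⟨List.mem_range.2 (by omega), List.mem_range.2 ?_⟩
        rcases h5.eq_or_lt with rfl | hlt
        · rw [hx.last]; omega
        · have := hx.mono p (k + 1) hlt le_rfl
          rw [hx.last] at this; omega
      · rw [Candidate.valid, Bool.and_eq_true, Bool.and_eq_true]
        refine ⟨⟨consistent_iff.2 fun q hq r hr => ?_, List.all_eq_true.2 fun j hj => ?_⟩, ?_⟩
        · obtain ⟨hq1, hq2⟩ := hgood q hq
          obtain ⟨hr1, hr2⟩ := hgood r hr
          rw [← hq2, ← hr2, hx.le_iff hq1 hr1, hx.le_iff hr1 hq1]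
          exact ⟨Iff.rfl, Iff.rfl⟩
        · rw [Bool.not_eq_true']
          exact refutes_sound hp hv hn (hx.windowForces_sound fun q hq =>
            hgood q (List.mem_cons_of_mem _ (List.mem_cons_of_mem _ hq))) (h4 j hj).1 (h4 j hj).2.2
        · rw [hblock]
          by_cases hAE : A = E.map fun q => q.1
          · simp only [hAE, decide_true, Bool.not_true, Bool.false_or, hout]
            rw [map_fst_eq_self fun q hq => (h3 q hq).2]
            exact h6
          · simp [hAE]
    · refine Bool.and_eq_true_iff.2 ⟨consistent_iff.2 fun q hq r hr => ?_, decide_eq_true rfl⟩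
      obtain ⟨p, hp, rfl⟩ := List.mem_map.1 hq
      obtain ⟨p', hp', rfl⟩ := List.mem_map.1 hr
      have h1 := hAk p hp
      have h2 := List.mem_range.1 ((mem_listsLE.1 hB).2 p' hp')
      dsimp only
      rw [hx.le_iff h1 (by omega), hx.le_iff (by omega) h1]
      exact ⟨Iff.rfl, Iff.rfl⟩
  · rintro ⟨F, hF⟩
    have hnil : [] ∈ blocks d k := mem_listsLE.2 (by simp)
    have hsing (p : ℕ) (hp : p ≤ k + 1) : [p] ∈ blocks d k :=
      mem_listsLE.2 ⟨by simpa using hR, by simp; omega⟩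
    obtain ⟨x, hx⟩ : ∃ x : ℕ → ℕ, ∀ p ≤ k + 1, (F [p]).1 = [(p, x p)] := by
      have : ∀ p, ∃ y, p ≤ k + 1 → (F [p]).1 = [(p, y)] := by
        intro p
        by_cases hp : p ≤ k + 1
        · have h := (hF _ (hsing p hp)).2.1
          obtain ⟨q, hq, h1⟩ := List.map_eq_singleton_iff.1 h
          exact ⟨q.2, fun _ => by rw [hq, ← h1]⟩
        · exact ⟨0, fun h => absurd h hp⟩
      choose x hx using this
      exact ⟨x, hx⟩
    have hcons (A B : List ℕ) (hA : A ∈ blocks d k) (hB : B ∈ blocks d k) :=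
      consistent_iff.1 (Bool.and_eq_true_iff.1 ((hF A hA).2.2 B hB)).1
    have hval (A : List ℕ) (hA : A ∈ blocks d k) :=
      Bool.and_eq_true_iff.1 (List.mem_filter.1 (hF A hA).1).2
    have hself (p : ℕ) (hp : p ≤ k + 1) :=
      consistent_iff.1 (Bool.and_eq_true_iff.1 (hval [p] (hsing p hp)).1).1
    have mono : ∀ p q, p < q → q ≤ k + 1 → x p < x q := fun p q hpq hq => by
      have := hcons [p] [q] (hsing p (by omega)) (hsing q hq) (p, x p)
        (by simp [hx p (by omega)]) (q, x q) (by simp [hx q hq])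
      exact this.1.1 hpq
    -- Validity includes consistency with the sentinel pairs, which fixes both ends of the sequence.
    have zero : x 0 = 0 := by
      have := hself 0 (by omega) (0, 0) (by simp) (0, x 0) (by simp [hx 0 (by omega)])
      simp at this; omega
    have last : x (k + 1) = n + 1 := by
      have := hself (k + 1) le_rfl (k + 1, n + 1) (by simp) (k + 1, x (k + 1))
        (by simp [hx (k + 1) le_rfl])
      simp only [lt_irrefl, false_iff] at this; omega
    have hgood (A : List ℕ) (hA : A ∈ blocks d k) :
        ∀ q ∈ (F A).1, q.1 ≤ k + 1 ∧ x q.1 = q.2 := by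
      intro q hq
      have h1 : q.1 ∈ A := by
        rw [← (hF A hA).2.1]
        exact List.mem_map_of_mem hq
      have h2 := List.mem_range.1 ((mem_listsLE.1 hA).2 _ h1)
      -- Consistency of two pairs with the same position rules out both strict inequalities between
      -- their values.
      have := hcons A [q.1] hA (hsing q.1 (by omega)) q hq (q.1, x q.1)
        (by simp [hx q.1 (by omega)])
      simp only [lt_irrefl, false_iff] at this
      omega
    obtain ⟨S, hS, hk, hen⟩ := exists_set_of_enumeration mono zero last
    refine ⟨S, hS, hk, ?_⟩
    rw [C.eval_eq_values]
    have hv : ∀ j < C.gates.length, C.values S j = (gateAt C.gates j).valueFun S (C.values S) :=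
      fun j hj => hC.values_eq S hj
    -- All candidates carry the same certificate; the empty block serves as a reference.
    set γ := (F []).2 with hγ
    have hcert (A : List ℕ) (hA : A ∈ blocks d k) : (F A).2 = γ :=
      of_decide_eq_true (Bool.and_eq_true_iff.1 ((hF A hA).2.2 [] hnil)).2
    have hmem : γ.1 ∈ listsLE (List.range C.gates.length) (2 ^ d) ∧ γ.2 ∈ blocks d k := by
      have := (List.mem_filter.1 (hF [] hnil).1).1
      exact List.mem_product.1 (List.mem_product.1 this).2
    have hassume : ∀ j ∈ γ.1, assumable C.gates d j = true →
        C.values S j = (gateAt C.gates j).polarity := by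
      intro j hj ha
      refine refutes_complete hp hv hn hen.windowForces_complete
        (List.mem_range.1 ((mem_listsLE.1 hmem.1).2 j hj)) ha fun w hw hwg => ?_
      have hA : (w.map fun q => q.1) ∈ blocks d k := by
        refine mem_listsLE.2 ⟨by simpa using hw, fun a ha => ?_⟩
        obtain ⟨q, hq, rfl⟩ := List.mem_map.1 ha
        exact List.mem_range.2 (by have := (hwg q hq).1; omega)
      -- The candidate chosen for the positions of a true window has exactly this window, so its
      -- validity says that the window refutes nothing.
      have h1 : (F (w.map fun q => q.1)).1 = w := by
        have e1 := map_fst_eq_self fun q hq => (hwg q hq).2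
        have e2 := map_fst_eq_self fun q hq => (hgood _ hA q hq).2
        exact e2.symm.trans ((congrArg (List.map fun p => (p, x p)) (hF _ hA).2.1).trans e1)
      have h2 := List.all_eq_true.1 (Bool.and_eq_true_iff.1 (hval _ hA).1).2 j
        (by rw [hcert _ hA]; exact hj)
      rw [h1] at h2
      simpa using h2
    -- On the block named in the certificate, validity requires that the output is forced to be
    -- true.
    have hE := (hval γ.2 hmem.2).2
    rw [(hF _ hmem.2).2.1, hcert _ hmem.2, hout] at hE
    simp only [decide_true, Bool.not_true, Bool.false_or] at hE
    exact forces_sound hp hv hn (hen.windowForces_sound (hgood _ hmem.2)) hassume (by omega) hE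

/-! ### Paths in color graphs -/

/-- The hypothesis compares `α` and `γ` across each edge, in both directions since adjacency is
symmetric. Every mixture of the two colorings is then proper, so the differing vertices may be
recolored one at a time in any order. -/
theorem exists_colorGraph_walk {V : Type} [Fintype V] [DecidableEq V] {G : SimpleGraph V} {k : ℕ}
    (m : ℕ) (α γ : G.Coloring (Fin k)) (h : ∀ u v, G.Adj u v → α u ≠ γ v)
    (hm : (Finset.univ.filter fun v => α v ≠ γ v).card ≤ m) :
    ∃ w : (colorGraph G k).Walk α γ, w.length ≤ m := by
  induction m generalizing α with
  | zero =>
    have : α = γ := by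
      ext v
      by_contra hv
      have : v ∈ Finset.univ.filter fun v => α v ≠ γ v := by
        rw [Finset.mem_filter]
        exact ⟨Finset.mem_univ v, fun h => hv (congrArg _ h)⟩
      rw [Finset.card_eq_zero.1 (Nat.le_zero.1 hm)] at this
      exact absurd this (Finset.notMem_empty v)
    subst this
    exact ⟨.nil, le_rfl⟩
  | succ m ih =>
    by_cases hα : α = γ
    · subst hα
      exact ⟨.nil, Nat.zero_le _⟩
    obtain ⟨v, hv⟩ : ∃ v, α v ≠ γ v := by
      by_contra hne
      push Not at hne
      exact hα (RelHom.ext hne)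
    let α' : G.Coloring (Fin k) := SimpleGraph.Coloring.mk (fun u => if u = v then γ v else α u) (by
      intro a b hab
      by_cases ha : a = v <;> by_cases hb : b = v
      · subst ha hb; exact absurd hab (G.irrefl)
      · subst ha; simpa [hb] using (h b a hab.symm).symm
      · subst hb; simpa [ha] using h a b hab
      · simpa [ha, hb] using α.valid hab)
    have hα' (u : V) : α' u = if u = v then γ v else α u := rfl
    have hadj : (colorGraph G k).Adj α α' := by
      refine ⟨v, by simpa [hα'] using hv, fun u hu => ?_⟩
      by_contra hne
      simp [hα', hne] at hu
    obtain ⟨w, hw⟩ := ih α' (fun a b hab => by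
      rw [hα']
      split_ifs with ha
      · subst ha; exact γ.valid hab
      · exact h a b hab) (by
      have hss : (Finset.univ.filter fun u => α' u ≠ γ u) ⊂
          Finset.univ.filter fun u => α u ≠ γ u := by
        refine Finset.ssubset_iff_subset_ne.2 ⟨fun u hu => ?_, fun he => ?_⟩
        · rw [Finset.mem_filter, hα'] at hu
          rw [Finset.mem_filter]
          refine ⟨hu.1, ?_⟩
          by_cases huv : u = v
          · subst huv; simp at hu
          · simpa [huv] using hu.2
        · have : v ∈ Finset.univ.filter fun u => α' u ≠ γ u := by
            rw [he]; simpa using hv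
          simp [hα'] at this
      have := Finset.card_lt_card hss
      omega)
    exact ⟨.cons hadj w, by simpa using hw⟩

theorem card_filter_getElem {α : Type} (l : List α) (p : α → Bool) :
    (Finset.univ.filter fun i : Fin l.length => p l[i] = true).card = l.countP p := by
  have h : l = (List.finRange l.length).map fun i => l[i] := by
    simp
  conv_rhs => rw [h, List.countP_map, List.countP_eq_length_filter]
  rw [← List.toFinset_card_of_nodup ((List.nodup_finRange _).filter _)]
  congr 1
  ext i
  simp

theorem ofFn_eq_map {α β : Type} (l : List α) (f : α → β) :
    (List.ofFn fun i : Fin l.length => f l[i]) = l.map f := by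
  have h := congrArg (List.map f) (List.ofFn_getElem (xs := l))
  rwa [List.map_ofFn] at h

theorem ofFn_injective' {α : Type} {n : ℕ} {f g : Fin n → α} (h : List.ofFn f = List.ofFn g)
    (i : Fin n) : f i = g i := congrFun (List.ofFn_injective h) i

/-- The encoding determines the graph, the number of colors and both colorings. Paths may be
replaced by walks, since bypassing loops does not lengthen a walk. -/
theorem mem_lengthColorPath_iff {n k : ℕ} (G : SimpleGraph (Fin n)) (α β : G.Coloring (Fin k))
    (l : ℕ) : (Data.node (encodeGraph G)
      (Data.node (Data.ofNat k) (Data.node (encodeColoring α) (encodeColoring β))), l) ∈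
        LengthColorPath ↔ ∃ w : (colorGraph G k).Walk α β, w.length ≤ l := by
  classical
  constructor
  · rintro ⟨n', k', G', α', β', he, w, -, hw⟩
    simp only [Data.node.injEq] at he
    obtain ⟨h1, h2, h3, h4⟩ := he
    have hn : n = n' := by
      have := congrArg List.length (Data.ofList_injective h1)
      simpa using this
    subst hn
    have hk : k = k' := Data.ofNat_injective h2
    subst hk
    have hG : G = G' := by
      ext i j
      have h5 := ofFn_injective' (Data.ofList_injective h1) i
      have h6 := ofFn_injective' (Data.ofList_injective h5) j
      simpa using (Enc.inj h6 : decide (G.Adj i j) = decide (G'.Adj i j))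
    subst hG
    have hc (α α' : G.Coloring (Fin k)) (h : encodeColoring α = encodeColoring α') : α = α' := by
      refine RelHom.ext fun v => Fin.ext ?_
      exact Data.ofNat_injective (ofFn_injective' (Data.ofList_injective h) v)
    obtain rfl := hc _ _ h3
    obtain rfl := hc _ _ h4
    exact ⟨w, hw⟩
  · rintro ⟨w, hw⟩
    exact ⟨n, k, G, α, β, rfl, w.bypass, w.bypass_isPath, w.length_bypass_le_length.trans hw⟩

/-! ### The graph of the reduction -/

/-- Vertices of the graph: their kind (palette, candidate, selector of a block, switch), the
colors that they may take, and a candidate. -/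
abbrev Vertex : Type := ℕ × List ℕ × Candidate

/-- One half of the adjacency relation. -/
def linkedTo (u v : Vertex) : Bool :=
  if u.1 = 0 then !decide (u.2.1.headD 0 ∈ v.2.1)
  else if v.1 = 0 then false
  else if u.1 = v.1 then decide (u.1 = 1) && !Candidate.compatible u.2.2 v.2.2
  else true

/-- The adjacency relation. -/
def linked (u v : Vertex) : Bool := linkedTo u v || linkedTo v u

/-- The candidate with a given index. -/
def candAt (cs : List Candidate) (c : ℕ) : Candidate := cs.getD c ([], [], [])

/-- The colors of a selector. -/
def selectorColors (cs : List Candidate) (A : List ℕ) : List ℕ :=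
  1 :: 2 :: ((List.range cs.length).filter fun c =>
    decide (Candidate.block (candAt cs c) = A)).map fun c => 3 + c

/-- The list of all vertices. -/
def vertices (cs : List Candidate) (bs : List (List ℕ)) : List Vertex :=
  ((List.range (cs.length + 3)).map fun a => (0, [a], ([], [], []))) ++
  (((List.range cs.length).map fun c => (1, [3 + c, 0], candAt cs c)) ++
  ((bs.map fun A => (2, selectorColors cs A, ([], [], A))) ++ [(3, [2, 1], ([], [], []))]))

/-- The initial color of a vertex. -/
def startColor (u : Vertex) : ℕ := u.2.1.headD 0

/-- The final color of a vertex. -/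
def endColor (u : Vertex) : ℕ := if 1 < u.1 then u.2.1.getD 1 0 else u.2.1.headD 0

/-- The color of a vertex in a stage of the recoloring, when the candidates in `I` may be switched
off and the selector of `A` may point at the candidate `f A`. -/
def stageColor (I : ℕ → Bool) (f : List ℕ → ℕ) (on : Bool) (t p : ℕ) (u : Vertex) : ℕ :=
  if u.1 = 0 then u.2.1.headD 0
  else if u.1 = 1 then (if on && I (u.2.1.headD 0 - 3) then 0 else u.2.1.headD 0)
  else if u.1 = 2 then (if t = 0 then 3 + f u.2.2.2.2 else t)
  else p

theorem mem_vertices {cs : List Candidate} {bs : List (List ℕ)} {u : Vertex} :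
    u ∈ vertices cs bs ↔ (∃ a < cs.length + 3, u = (0, [a], ([], [], []))) ∨
      (∃ c < cs.length, u = (1, [3 + c, 0], candAt cs c)) ∨
      (∃ A ∈ bs, u = (2, selectorColors cs A, ([], [], A))) ∨ u = (3, [2, 1], ([], [], [])) := by
  simp only [vertices, List.mem_append, List.mem_map, List.mem_range, List.mem_singleton, eq_comm]

section

variable {cs : List Candidate} {bs : List (List ℕ)}

theorem linked_comm (u v : Vertex) : linked u v = linked v u := Bool.or_comm _ _

theorem linked_self (hcs : ∀ c ∈ cs, Candidate.compatible c c = true) {u : Vertex}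
    (hu : u ∈ vertices cs bs) : linked u u = false := by
  rcases mem_vertices.1 hu with ⟨a, ha, rfl⟩ | ⟨c, hc, rfl⟩ | ⟨A, hA, rfl⟩ | rfl
  · simp [linked, linkedTo]
  · have : candAt cs c ∈ cs := by
      rw [candAt, List.getD_eq_getElem _ _ hc]
      exact List.getElem_mem hc
    simp [linked, linkedTo, hcs _ this]
  · simp [linked, linkedTo]
  · simp [linked, linkedTo]

theorem mem_selectorColors {A : List ℕ} {a : ℕ} : a ∈ selectorColors cs A ↔
    a = 1 ∨ a = 2 ∨ ∃ c < cs.length, (candAt cs c).block = A ∧ a = 3 + c := by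
  simp only [selectorColors, List.mem_cons, List.mem_map, List.mem_filter, List.mem_range,
    decide_eq_true_eq, and_assoc, eq_comm (b := a)]

theorem color_lt {u : Vertex} (hu : u ∈ vertices cs bs) {a : ℕ} (ha : a ∈ u.2.1) :
    a < cs.length + 3 := by
  rcases mem_vertices.1 hu with ⟨b, hb, rfl⟩ | ⟨c, hc, rfl⟩ | ⟨A, hA, rfl⟩ | rfl
  · rw [List.mem_singleton] at ha; omega
  · simp at ha; omega
  · have := mem_selectorColors.1 ha; omega
  · simp at ha; omega

variable (cs bs) in
/-- The graph of the reduction. -/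
def reductionGraph (hcs : ∀ c ∈ cs, Candidate.compatible c c = true) :
    SimpleGraph (Fin (vertices cs bs).length) where
  Adj i j := linked (vertices cs bs)[i] (vertices cs bs)[j] = true
  symm := ⟨fun i j h => by rwa [linked_comm]⟩
  loopless := ⟨fun i h => by
    exact absurd ((linked_self hcs (List.getElem_mem i.2)).symm.trans h) (by decide)⟩

/-- A coloring of the graph, given by the colors of the vertex descriptions. -/
def reductionColoring (hcs : ∀ c ∈ cs, Candidate.compatible c c = true) (f : Vertex → ℕ)
    (h1 : ∀ u ∈ vertices cs bs, f u ∈ u.2.1)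
    (h2 : ∀ u ∈ vertices cs bs, ∀ v ∈ vertices cs bs, linked u v = true → f u ≠ f v) :
    (reductionGraph cs bs hcs).Coloring (Fin (cs.length + 3)) :=
  SimpleGraph.Coloring.mk
    (fun i => ⟨f (vertices cs bs)[i],
      color_lt (List.getElem_mem _) (h1 _ (List.getElem_mem _))⟩)
    (fun hij h => h2 _ (List.getElem_mem _) _ (List.getElem_mem _) hij (Fin.mk.inj_iff.1 h))

theorem stageColor_candidate (I : ℕ → Bool) (f : List ℕ → ℕ) (on : Bool) (t p c : ℕ)
    (x : Candidate) : stageColor I f on t p (1, [3 + c, 0], x) =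
      if (on && I c) = true then 0 else 3 + c := by
  simp [stageColor]

theorem stageColor_selector (I : ℕ → Bool) (f : List ℕ → ℕ) (on : Bool) (t p : ℕ) (l A : List ℕ) :
    stageColor I f on t p (2, l, ([], [], A)) = if t = 0 then 3 + f A else t := by
  simp [stageColor]

theorem stageColor_switch (I : ℕ → Bool) (f : List ℕ → ℕ) (on : Bool) (t p : ℕ) (l : List ℕ)
    (x : Candidate) : stageColor I f on t p (3, l, x) = p := by
  simp [stageColor]

/-- A pointing selector (`t' = 0`) could only clash with the candidate it points at, and that one is
switched off. -/
theorem stageColor_candidate_ne_selector {I : ℕ → Bool} {f : List ℕ → ℕ} {on on' : Bool}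
    {t t' p p' c : ℕ} {x : Candidate} {l A : List ℕ} (ht' : t' ≤ 2) (hI : t' = 0 → I (f A) = true)
    (hon : t' = 0 → on = true) :
    stageColor I f on t p (1, [3 + c, 0], x) ≠ stageColor I f on' t' p' (2, l, ([], [], A)) := by
  rw [stageColor_candidate, stageColor_selector]
  by_cases h0 : t' = 0
  · rw [if_pos h0, hon h0, Bool.true_and]
    split_ifs with h
    · omega
    · intro he
      have : c = f A := by omega
      exact h (this ▸ hI h0)
  · rw [if_neg h0]
    split_ifs <;> omega

theorem stageColor_candidate_ne_switch {I : ℕ → Bool} {f : List ℕ → ℕ} {on on' : Bool}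
    {t t' p p' c : ℕ} {x y : Candidate} {l : List ℕ} (hp' : p' = 1 ∨ p' = 2) :
    stageColor I f on t p (1, [3 + c, 0], x) ≠ stageColor I f on' t' p' (3, l, y) := by
  rw [stageColor_candidate, stageColor_switch]
  split_ifs <;> omega

theorem stageColor_selector_ne_switch {I : ℕ → Bool} {f : List ℕ → ℕ} {on on' : Bool}
    {t t' p p' : ℕ} {y : Candidate} {l l' A : List ℕ} (hp' : p' = 1 ∨ p' = 2) (h : t ≠ p') :
    stageColor I f on t p (2, l, ([], [], A)) ≠ stageColor I f on' t' p' (3, l', y) := by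
  rw [stageColor_selector, stageColor_switch]
  split_ifs <;> omega

theorem stageColor_mem {I : ℕ → Bool} {f : List ℕ → ℕ} {on : Bool} {t p : ℕ} (ht : t ≤ 2)
    (hp : p = 1 ∨ p = 2)
    (hf : t = 0 → ∀ A ∈ bs, f A < cs.length ∧ (candAt cs (f A)).block = A) {u : Vertex}
    (hu : u ∈ vertices cs bs) : stageColor I f on t p u ∈ u.2.1 := by
  rcases mem_vertices.1 hu with ⟨b, hb, rfl⟩ | ⟨c, hc, rfl⟩ | ⟨A, hA, rfl⟩ | rfl
  · simp [stageColor]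
  · rw [stageColor_candidate]
    split_ifs <;> simp
  · rw [stageColor_selector, mem_selectorColors]
    split_ifs with h
    · exact Or.inr (Or.inr ⟨f A, (hf h A hA).1, (hf h A hA).2, rfl⟩)
    · omega
  · rw [stageColor_switch]
    rcases hp with rfl | rfl <;> simp

theorem linkedTo_palette {u v : Vertex} (h : linkedTo u v = true) (hu : u.1 = 0) :
    u.2.1.headD 0 ∉ v.2.1 := by
  rw [linkedTo, if_pos hu] at h
  simpa using h

/-- Two stages are compared across an edge, as `exists_colorGraph_walk` requires; with equal stages
this is properness of a single one. Selectors may point in one stage only if candidates are off in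
the other, and the selector color of one stage must differ from the switch color of the other. -/
theorem stageColor_ne_of_linkedTo {I : ℕ → Bool} {f : List ℕ → ℕ} {on on' : Bool} {t t' p p' : ℕ}
    (ht : t ≤ 2) (ht' : t' ≤ 2) (hp : p = 1 ∨ p = 2) (hp' : p' = 1 ∨ p' = 2)
    (hcs : ∀ c ∈ cs, Candidate.compatible c c = true)
    (hf : t' = 0 → ∀ A ∈ bs, f A < cs.length ∧ (candAt cs (f A)).block = A)
    (hI : ∀ c c', I c = true → I c' = true →
      Candidate.compatible (candAt cs c) (candAt cs c') = true)
    (hIf : t = 0 ∨ t' = 0 → ∀ A ∈ bs, I (f A) = true)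
    (h1 : t = 0 → on' = true) (h2 : t' = 0 → on = true) (h3 : t ≠ p') (h4 : t' ≠ p)
    {u v : Vertex} (hu : u ∈ vertices cs bs) (hv : v ∈ vertices cs bs)
    (h : linkedTo u v = true) : stageColor I f on t p u ≠ stageColor I f on' t' p' v := by
  have hvm : stageColor I f on' t' p' v ∈ v.2.1 :=
    stageColor_mem ht' hp' hf hv
  rcases mem_vertices.1 hu with ⟨b, hb, rfl⟩ | ⟨c, hc, rfl⟩ | ⟨A, hA, rfl⟩ | rfl
  · intro he
    rw [← he] at hvm
    exact linkedTo_palette h rfl hvm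
  · rcases mem_vertices.1 hv with ⟨b', hb', rfl⟩ | ⟨c', hc', rfl⟩ | ⟨A', hA', rfl⟩ | rfl
    · simp [linkedTo] at h
    · have hcand : candAt cs c ∈ cs := by
        rw [candAt, List.getD_eq_getElem _ _ hc]
        exact List.getElem_mem hc
      have h : Candidate.compatible (candAt cs c) (candAt cs c') = false := by
        simpa [linkedTo] using h
      rw [stageColor_candidate, stageColor_candidate]
      split_ifs with e1 e2 e2
      · rw [Bool.and_eq_true] at e1 e2
        rw [hI c c' e1.2 e2.2] at h
        exact absurd h (by decide)
      · omega
      · omega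
      · intro he
        have hcc : c = c' := by omega
        rw [← hcc, hcs _ hcand] at h
        exact absurd h (by decide)
    · exact stageColor_candidate_ne_selector ht' (fun h => hIf (Or.inr h) A' hA') h2
    · exact stageColor_candidate_ne_switch hp'
  · rcases mem_vertices.1 hv with ⟨b', hb', rfl⟩ | ⟨c', hc', rfl⟩ | ⟨A', hA', rfl⟩ | rfl
    · simp [linkedTo] at h
    · exact (stageColor_candidate_ne_selector ht (fun h => hIf (Or.inl h) A hA) h1).symm
    · simp [linkedTo] at h
    · exact stageColor_selector_ne_switch hp' h3
  · rcases mem_vertices.1 hv with ⟨b', hb', rfl⟩ | ⟨c', hc', rfl⟩ | ⟨A', hA', rfl⟩ | rfl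
    · simp [linkedTo] at h
    · exact (stageColor_candidate_ne_switch hp).symm
    · exact (stageColor_selector_ne_switch hp h4).symm
    · simp [linkedTo] at h

end

/-! ### Both directions of the reduction to recoloring -/

section

variable {cs : List Candidate} {bs : List (List ℕ)}

theorem startColor_eq {u : Vertex} (hu : u ∈ vertices cs bs) (I : ℕ → Bool) (f : List ℕ → ℕ) :
    startColor u = stageColor I f false 1 2 u := by
  rcases mem_vertices.1 hu with ⟨b, hb, rfl⟩ | ⟨c, hc, rfl⟩ | ⟨A, hA, rfl⟩ | rfl <;>
  simp [startColor, stageColor, selectorColors]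

theorem endColor_eq {u : Vertex} (hu : u ∈ vertices cs bs) (I : ℕ → Bool) (f : List ℕ → ℕ) :
    endColor u = stageColor I f false 2 1 u := by
  rcases mem_vertices.1 hu with ⟨b, hb, rfl⟩ | ⟨c, hc, rfl⟩ | ⟨A, hA, rfl⟩ | rfl <;>
  simp [endColor, stageColor, selectorColors]

theorem startColor_mem {u : Vertex} (hu : u ∈ vertices cs bs) : startColor u ∈ u.2.1 := by
  rw [startColor_eq hu (fun _ => false) fun _ => 0]
  exact stageColor_mem (by omega) (by omega) (by omega) hu

theorem endColor_mem {u : Vertex} (hu : u ∈ vertices cs bs) : endColor u ∈ u.2.1 := by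
  rw [endColor_eq hu (fun _ => false) fun _ => 0]
  exact stageColor_mem (by omega) (by omega) (by omega) hu

theorem ne_of_linked {f g : Vertex → ℕ} (h : ∀ u ∈ vertices cs bs, ∀ v ∈ vertices cs bs,
    linkedTo u v = true → f u ≠ g v ∧ g u ≠ f v) {u v : Vertex} (hu : u ∈ vertices cs bs)
    (hv : v ∈ vertices cs bs) (huv : linked u v = true) : f u ≠ g v := by
  rcases Bool.or_eq_true_iff.1 huv with huv | huv
  · exact (h u hu v hv huv).1
  · exact (h v hv u hu huv).2.symm

theorem startColor_ne (hcs : ∀ c ∈ cs, Candidate.compatible c c = true) {u v : Vertex}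
    (hu : u ∈ vertices cs bs) (hv : v ∈ vertices cs bs) (huv : linked u v = true) :
    startColor u ≠ startColor v := by
  refine ne_of_linked (fun u hu v hv huv => ?_) hu hv huv
  rw [startColor_eq hu (fun _ => false) fun _ => 0, startColor_eq hv (fun _ => false) fun _ => 0,
    and_self]
  exact stageColor_ne_of_linkedTo (by omega) (by omega) (by omega) (by omega) hcs (by omega)
    (by simp) (by omega) (by omega) (by omega) (by omega) (by omega) hu hv huv

theorem endColor_ne (hcs : ∀ c ∈ cs, Candidate.compatible c c = true) {u v : Vertex}
    (hu : u ∈ vertices cs bs) (hv : v ∈ vertices cs bs) (huv : linked u v = true) :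
    endColor u ≠ endColor v := by
  refine ne_of_linked (fun u hu v hv huv => ?_) hu hv huv
  rw [endColor_eq hu (fun _ => false) fun _ => 0, endColor_eq hv (fun _ => false) fun _ => 0,
    and_self]
  exact stageColor_ne_of_linkedTo (by omega) (by omega) (by omega) (by omega) hcs (by omega)
    (by simp) (by omega) (by omega) (by omega) (by omega) (by omega) hu hv huv

theorem countP_mem_map_le {f : List ℕ → ℕ} (m : ℕ) :
    (List.range m).countP (fun c => decide (c ∈ bs.map f)) ≤ bs.length := by
  rw [List.countP_eq_length_filter,
    ← List.toFinset_card_of_nodup (List.nodup_range.filter _)]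
  calc _ ≤ (bs.map f).toFinset.card := Finset.card_le_card fun c hc => by
          simp only [List.mem_toFinset, List.mem_filter, decide_eq_true_eq] at hc ⊢
          exact hc.2
    _ ≤ _ := (List.toFinset_card_le _).trans (by simp)

theorem countP_stageColor_ne_le {f : List ℕ → ℕ} (on on' : Bool) (t t' p p' : ℕ) :
    (vertices cs bs).countP (fun u =>
      decide (stageColor (fun c => decide (c ∈ bs.map f)) f on t p u ≠
        stageColor (fun c => decide (c ∈ bs.map f)) f on' t' p' u)) ≤
      (if on = on' then 0 else bs.length) + (if t = t' then 0 else bs.length) +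
        (if p = p' then 0 else 1) := by
  rw [vertices, List.countP_append, List.countP_append, List.countP_append, List.countP_map,
    List.countP_map, List.countP_map]
  have h1 : (List.range (cs.length + 3)).countP ((fun u =>
      decide (stageColor (fun c => decide (c ∈ bs.map f)) f on t p u ≠
        stageColor (fun c => decide (c ∈ bs.map f)) f on' t' p' u)) ∘
          fun a => (0, [a], ([], [], []))) = 0 := by
    rw [List.countP_eq_zero]
    intro a _
    simp [stageColor]
  have h2 : (List.range cs.length).countP ((fun u =>
      decide (stageColor (fun c => decide (c ∈ bs.map f)) f on t p u ≠
        stageColor (fun c => decide (c ∈ bs.map f)) f on' t' p' u)) ∘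
          fun c => (1, [3 + c, 0], candAt cs c)) ≤ if on = on' then 0 else bs.length := by
    split_ifs with h
    · subst h
      rw [Nat.le_zero, List.countP_eq_zero]
      intro c _
      simp [stageColor_candidate]
    -- Only candidates with index in `bs.map f` can change, at most one for each block.
    · refine (List.countP_mono_left fun c _ hc => ?_).trans
        (countP_mem_map_le (bs := bs) (f := f) cs.length)
      by_contra hI
      rw [Bool.not_eq_true] at hI
      simp only [Function.comp_apply, stageColor_candidate, hI, Bool.and_false] at hc
      simp at hc
  have h3 : bs.countP ((fun u =>
      decide (stageColor (fun c => decide (c ∈ bs.map f)) f on t p u ≠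
        stageColor (fun c => decide (c ∈ bs.map f)) f on' t' p' u)) ∘
          fun A => (2, selectorColors cs A, ([], [], A))) ≤ if t = t' then 0 else bs.length := by
    split_ifs with h
    · subst h
      rw [Nat.le_zero, List.countP_eq_zero]
      intro c _
      simp [stageColor_selector]
    · exact List.countP_le_length
  have h4 : [((3, [2, 1], ([], [], [])) : Vertex)].countP (fun u =>
      decide (stageColor (fun c => decide (c ∈ bs.map f)) f on t p u ≠
        stageColor (fun c => decide (c ∈ bs.map f)) f on' t' p' u)) ≤
          if p = p' then 0 else 1 := by
    split_ifs with h
    · subst h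
      simp [stageColor_switch]
    · exact List.countP_le_length
  omega

/-- Five phases: switch the chosen candidates off, let the selectors point at them, flip the switch,
move the selectors to their final color, switch the candidates on again. Four phases cost at most
`bs.length` each, and the flip costs one. -/
theorem reduction_complete (hcs : ∀ c ∈ cs, Candidate.compatible c c = true)
    {F : List ℕ → Candidate} (hF : ∀ A ∈ bs, F A ∈ cs ∧ (F A).block = A ∧
      ∀ B ∈ bs, Candidate.compatible (F A) (F B) = true) :
    ∃ w : (colorGraph (reductionGraph cs bs hcs) (cs.length + 3)).Walk
      (reductionColoring hcs startColor (fun _ => startColor_mem)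
        fun _ hu _ hv => startColor_ne hcs hu hv)
      (reductionColoring hcs endColor (fun _ => endColor_mem)
        fun _ hu _ hv => endColor_ne hcs hu hv), w.length ≤ 4 * bs.length + 1 := by
  have hex : ∀ A, ∃ c, A ∈ bs → c < cs.length ∧ candAt cs c = F A := by
    intro A
    by_cases hA : A ∈ bs
    · obtain ⟨c, hc, he⟩ := List.mem_iff_getElem.1 (hF A hA).1
      exact ⟨c, fun _ => ⟨hc, by rw [candAt, List.getD_eq_getElem _ _ hc, he]⟩⟩
    · exact ⟨0, fun h => absurd h hA⟩
  choose f hf using hex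
  have hfb : ∀ A ∈ bs, f A < cs.length ∧ (candAt cs (f A)).block = A := fun A hA =>
    ⟨(hf A hA).1, by rw [(hf A hA).2]; exact (hF A hA).2.1⟩
  set I : ℕ → Bool := fun c => decide (c ∈ bs.map f) with hIdef
  have hIf : ∀ A ∈ bs, I (f A) = true := fun A hA => decide_eq_true (List.mem_map_of_mem hA)
  have hI : ∀ c c', I c = true → I c' = true →
      Candidate.compatible (candAt cs c) (candAt cs c') = true := by
    intro c c' h h'
    obtain ⟨A, hA, rfl⟩ := List.mem_map.1 (of_decide_eq_true h)
    obtain ⟨B, hB, rfl⟩ := List.mem_map.1 (of_decide_eq_true h')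
    rw [(hf A hA).2, (hf B hB).2]
    exact (hF A hA).2.2 B hB
  have hne (on on' : Bool) (t t' p p' : ℕ) (ht : t ≤ 2) (ht' : t' ≤ 2) (hp : p = 1 ∨ p = 2)
      (hp' : p' = 1 ∨ p' = 2) (h1 : t = 0 → on' = true) (h2 : t' = 0 → on = true)
      (h3 : t ≠ p') (h4 : t' ≠ p) (u : Vertex) (hu : u ∈ vertices cs bs) (v : Vertex)
      (hv : v ∈ vertices cs bs) (huv : linked u v = true) :
      stageColor I f on t p u ≠ stageColor I f on' t' p' v :=
    ne_of_linked (fun u hu v hv huv =>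
      ⟨stageColor_ne_of_linkedTo ht ht' hp hp' hcs (fun _ => hfb) hI (fun _ => hIf) h1 h2 h3 h4
        hu hv huv,
      stageColor_ne_of_linkedTo ht' ht hp' hp hcs (fun _ => hfb) hI (fun _ => hIf) h2 h1 h4 h3
        hu hv huv⟩) hu hv huv
  have step (m : ℕ) (on on' : Bool) (t t' p p' : ℕ) (ht : t ≤ 2) (ht' : t' ≤ 2)
      (hp : p = 1 ∨ p = 2) (hp' : p' = 1 ∨ p' = 2) (h1 : t = 0 → on' = true)
      (h2 : t' = 0 → on = true) (h3 : t ≠ p') (h4 : t' ≠ p)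
      (hm : (if on = on' then 0 else bs.length) + (if t = t' then 0 else bs.length) +
        (if p = p' then 0 else 1) ≤ m)
      (α β : (reductionGraph cs bs hcs).Coloring (Fin (cs.length + 3)))
      (hα : ∀ i, (α i).val = stageColor I f on t p (vertices cs bs)[i])
      (hβ : ∀ i, (β i).val = stageColor I f on' t' p' (vertices cs bs)[i]) :
      ∃ w : (colorGraph (reductionGraph cs bs hcs) (cs.length + 3)).Walk α β, w.length ≤ m := by
    refine exists_colorGraph_walk m α β (fun i j hij he => ?_) (le_trans ?_ hm)
    · have := congrArg Fin.val he
      rw [hα, hβ] at this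
      exact hne on on' t t' p p' ht ht' hp hp' h1 h2 h3 h4 _ (List.getElem_mem _) _
        (List.getElem_mem _) hij this
    · refine le_trans (le_of_eq ?_) (countP_stageColor_ne_le (cs := cs) (f := f) on on' t t' p p')
      rw [← card_filter_getElem]
      congr 1
      ext i
      simp only [Finset.mem_filter, Finset.mem_univ, true_and, decide_eq_true_eq, Ne, Fin.ext_iff,
        hα, hβ, hIdef]
  let st (on : Bool) (t p : ℕ) (ht : t ≤ 2) (hp : p = 1 ∨ p = 2) (h1 : t = 0 → on = true)
      (h2 : t ≠ p) : (reductionGraph cs bs hcs).Coloring (Fin (cs.length + 3)) :=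
    reductionColoring hcs (stageColor I f on t p)
      (fun u hu => stageColor_mem ht hp (fun _ => hfb) hu)
      (hne on on t t p p ht ht hp hp h1 h1 h2 h2)
  -- The four intermediate stages, given by: candidates off, selector color (`0` for pointing),
  -- switch color.
  let s1 := st true 1 2 (by omega) (by omega) (by omega) (by omega)
  let s2 := st true 0 2 (by omega) (by omega) (by simp) (by omega)
  let s3 := st true 0 1 (by omega) (by omega) (by simp) (by omega)
  let s4 := st true 2 1 (by omega) (by omega) (by omega) (by omega)
  obtain ⟨w1, hw1⟩ := step bs.length false true 1 1 2 2 (by omega) (by omega) (by omega)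
    (by omega) (by omega) (by omega) (by omega) (by omega) (by simp)
    (reductionColoring hcs startColor (fun _ => startColor_mem)
        fun _ hu _ hv => startColor_ne hcs hu hv) s1
    (fun i => startColor_eq (List.getElem_mem _) I f) (fun i => rfl)
  obtain ⟨w2, hw2⟩ := step bs.length true true 1 0 2 2 (by omega) (by omega) (by omega)
    (by omega) (by omega) (by simp) (by omega) (by omega) (by simp) s1 s2
    (fun i => rfl) (fun i => rfl)
  obtain ⟨w3, hw3⟩ := step 1 true true 0 0 2 1 (by omega) (by omega) (by omega)
    (by omega) (by simp) (by simp) (by omega) (by omega) (by simp) s2 s3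
    (fun i => rfl) (fun i => rfl)
  obtain ⟨w4, hw4⟩ := step bs.length true true 0 2 1 1 (by omega) (by omega) (by omega)
    (by omega) (by simp) (by omega) (by omega) (by omega) (by simp) s3 s4
    (fun i => rfl) (fun i => rfl)
  obtain ⟨w5, hw5⟩ := step bs.length true false 2 2 1 1 (by omega) (by omega) (by omega)
    (by omega) (by omega) (by omega) (by omega) (by omega) (by simp) s4
    (reductionColoring hcs endColor (fun _ => endColor_mem)
        fun _ hu _ hv => endColor_ne hcs hu hv)
    (fun i => rfl) (fun i => endColor_eq (List.getElem_mem _) I f)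
  refine ⟨w1.append (w2.append (w3.append (w4.append w5))), ?_⟩
  simp only [SimpleGraph.Walk.length_append]
  omega

/-- Each color outside the list of a vertex is held by a palette vertex adjacent to it. -/
theorem color_mem_of_palette (hcs : ∀ c ∈ cs, Candidate.compatible c c = true)
    {γ : (reductionGraph cs bs hcs).Coloring (Fin (cs.length + 3))}
    (hγ : ∀ i, (vertices cs bs)[i].1 = 0 → (γ i).val = (vertices cs bs)[i].2.1.headD 0)
    (i : Fin (vertices cs bs).length) : (γ i).val ∈ (vertices cs bs)[i].2.1 := by
  by_contra h
  obtain ⟨j, hj, he⟩ := List.mem_iff_getElem.1 (mem_vertices.2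
    (Or.inl ⟨(γ i).val, (γ i).isLt, rfl⟩) :
      ((0, [(γ i).val], ([], [], [])) : Vertex) ∈ vertices cs bs)
  have h1 : (γ ⟨j, hj⟩).val = (γ i).val := by
    rw [hγ ⟨j, hj⟩ (by simp [he])]
    simp [he]
  have h2 : (reductionGraph cs bs hcs).Adj ⟨j, hj⟩ i := by
    change linked (vertices cs bs)[j] _ = true
    rw [linked, linkedTo, he]
    simpa using Or.inl h
  exact γ.valid h2 (Fin.ext h1)

/-- A recolored palette vertex would receive the color of another palette vertex, which is adjacent
to it and has not moved. So the palette stays frozen. -/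
theorem palette_of_adj (hcs : ∀ c ∈ cs, Candidate.compatible c c = true)
    {γ γ' : (reductionGraph cs bs hcs).Coloring (Fin (cs.length + 3))}
    (hγ : ∀ i, (vertices cs bs)[i].1 = 0 → (γ i).val = (vertices cs bs)[i].2.1.headD 0)
    (h : (colorGraph _ _).Adj γ γ') (i : Fin (vertices cs bs).length)
    (hi : (vertices cs bs)[i].1 = 0) : (γ' i).val = (vertices cs bs)[i].2.1.headD 0 := by
  obtain ⟨v, hv, huniq⟩ := h
  by_cases hiv : i = v
  · subst hiv
    exfalso
    have hlt : (γ' i).val < cs.length + 3 := (γ' i).isLt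
    obtain ⟨j, hj, he⟩ := List.mem_iff_getElem.1 (mem_vertices.2
      (Or.inl ⟨(γ' i).val, hlt, rfl⟩) :
        ((0, [(γ' i).val], ([], [], [])) : Vertex) ∈ vertices cs bs)
    have h1 : (γ ⟨j, hj⟩).val = (γ' i).val := by
      rw [hγ ⟨j, hj⟩ (by simp [he])]
      simp [he]
    have hne : (⟨j, hj⟩ : Fin (vertices cs bs).length) ≠ i := by
      rintro hji
      rw [hji] at h1
      exact hv (Fin.ext h1)
    have h2 : γ ⟨j, hj⟩ = γ' ⟨j, hj⟩ := by
      by_contra h3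
      exact hne (huniq _ h3)
    have hi' : (γ i).val ≠ (γ' i).val := fun h => hv (Fin.ext h)
    rw [hγ i hi] at hi'
    have h3 : (reductionGraph cs bs hcs).Adj i ⟨j, hj⟩ := by
      change linked (vertices cs bs)[i] (vertices cs bs)[j] = true
      rw [linked, linkedTo, he, if_pos hi]
      simpa using Or.inl hi'
    exact γ'.valid h3 (Fin.ext (by rw [← h2, h1]))
  · have : γ i = γ' i := by
      by_contra h3
      exact hiv (huniq _ h3)
    rw [← this]
    exact hγ i hi

/-- Look at the first step at which the switch leaves color `2`. No bound on the length of the walk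
is needed. -/
theorem reduction_sound (hcs : ∀ c ∈ cs, Candidate.compatible c c = true)
    {γ δ : (reductionGraph cs bs hcs).Coloring (Fin (cs.length + 3))}
    (w : (colorGraph (reductionGraph cs bs hcs) (cs.length + 3)).Walk γ δ)
    (hγ : ∀ i, (vertices cs bs)[i].1 = 0 → (γ i).val = (vertices cs bs)[i].2.1.headD 0)
    {s : Fin (vertices cs bs).length} (hs : (vertices cs bs)[s] = (3, [2, 1], ([], [], [])))
    (h1 : (γ s).val = 2) (h2 : (δ s).val = 1) :
    ∃ F : List ℕ → Candidate, ∀ A ∈ bs, F A ∈ cs ∧ (F A).block = A ∧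
      ∀ B ∈ bs, Candidate.compatible (F A) (F B) = true := by
  induction w with
  | nil => omega
  | cons h w ih =>
    rename_i γ γ' δ
    have hγ' := fun i => palette_of_adj hcs hγ h i
    have hmem := color_mem_of_palette hcs hγ' s
    by_cases h3 : (γ' s).val = 2
    · exact ih hγ' h3 h2
    have h4 : (γ' s).val = 1 := by
      rw [hs] at hmem
      simp at hmem
      omega
    obtain ⟨v, hv, huniq⟩ := h
    have hsv : s = v := huniq s fun he => by rw [he] at h1; omega
    have hex : ∀ A, ∃ c, A ∈ bs → c < cs.length ∧ (candAt cs c).block = A ∧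
        ∀ i : Fin (vertices cs bs).length,
          (vertices cs bs)[i] = (1, [3 + c, 0], candAt cs c) → (γ i).val = 0 := by
      intro A
      by_cases hA : A ∈ bs
      · obtain ⟨j, hj, he⟩ := List.mem_iff_getElem.1 (mem_vertices.2
          (Or.inr (Or.inr (Or.inl ⟨A, hA, rfl⟩))) :
            ((2, selectorColors cs A, ([], [], A)) : Vertex) ∈ vertices cs bs)
        have hjs : (⟨j, hj⟩ : Fin (vertices cs bs).length) ≠ s := by
          rintro rfl
          have := he.symm.trans hs
          simp at this
        have hadj : (reductionGraph cs bs hcs).Adj ⟨j, hj⟩ s := by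
          change linked (vertices cs bs)[j] (vertices cs bs)[s] = true
          rw [he, hs]
          simp [linked, linkedTo]
        -- Only the switch moves in this step, so the selector has the same color before and after;
        -- it avoids `2` because of the earlier coloring and `1` because of the later one.
        have e1 : (γ ⟨j, hj⟩).val ≠ 2 := fun h5 => γ.valid hadj (Fin.ext (h5.trans h1.symm))
        have e2 : (γ' ⟨j, hj⟩).val ≠ 1 := fun h5 => γ'.valid hadj (Fin.ext (h5.trans h4.symm))
        have e3 : γ ⟨j, hj⟩ = γ' ⟨j, hj⟩ := by
          by_contra h5
          exact hjs ((huniq _ h5).trans hsv.symm)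
        rw [← e3] at e2
        have e4 : (γ ⟨j, hj⟩).val ∈ (vertices cs bs)[j].2.1 := color_mem_of_palette hcs hγ ⟨j, hj⟩
        rw [he] at e4
        rcases mem_selectorColors.1 e4 with h5 | h5 | ⟨c, hc, hcA, h5⟩
        · exact absurd h5 e2
        · exact absurd h5 e1
        refine ⟨c, fun _ => ⟨hc, hcA, fun i hi => ?_⟩⟩
        have e5 := color_mem_of_palette hcs hγ i
        rw [hi] at e5
        have hadj' : (reductionGraph cs bs hcs).Adj i ⟨j, hj⟩ := by
          change linked (vertices cs bs)[i] (vertices cs bs)[j] = true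
          rw [he, hi]
          simp [linked, linkedTo]
        -- The selector holds `3 + c`, which leaves only `0` for the candidate vertex.
        have e6 : (γ i).val ≠ 3 + c := fun h6 => γ.valid hadj' (Fin.ext (h6.trans h5.symm))
        simpa [e6] using e5
      · exact ⟨0, fun h => absurd h hA⟩
    choose f hf using hex
    refine ⟨fun A => candAt cs (f A), fun A hA => ⟨?_, (hf A hA).2.1, fun B hB => ?_⟩⟩
    · change candAt cs (f A) ∈ cs
      rw [candAt, List.getD_eq_getElem _ _ (hf A hA).1]
      exact List.getElem_mem _
    · by_contra hne
      replace hne : Candidate.compatible (candAt cs (f A)) (candAt cs (f B)) = false :=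
        Bool.eq_false_of_not_eq_true hne
      obtain ⟨i, hi, he⟩ := List.mem_iff_getElem.1 (mem_vertices.2
          (Or.inr (Or.inl ⟨f A, (hf A hA).1, rfl⟩)) :
            ((1, [3 + f A, 0], candAt cs (f A)) : Vertex) ∈ vertices cs bs)
      obtain ⟨j, hj, he'⟩ := List.mem_iff_getElem.1 (mem_vertices.2
          (Or.inr (Or.inl ⟨f B, (hf B hB).1, rfl⟩)) :
            ((1, [3 + f B, 0], candAt cs (f B)) : Vertex) ∈ vertices cs bs)
      have hadj : (reductionGraph cs bs hcs).Adj ⟨i, hi⟩ ⟨j, hj⟩ := by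
        change linked (vertices cs bs)[i] (vertices cs bs)[j] = true
        rw [he, he']
        simp [linked, linkedTo, hne]
      -- Incompatible candidates would be adjacent vertices that both have color `0`.
      exact γ.valid hadj (Fin.ext (((hf A hA).2.2 ⟨i, hi⟩ he).trans
        ((hf B hB).2.2 ⟨j, hj⟩ he').symm))

/-- The tree that describes the instance with candidates `cs` and blocks `bs`. -/
def instanceData (cs : List Candidate) (bs : List (List ℕ)) : Data :=
  enc ((vertices cs bs).map fun u => (vertices cs bs).map fun v => linked u v,
    (cs.length + 3, (vertices cs bs).map fun u => startColor u,
      (vertices cs bs).map fun u => endColor u))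

theorem instanceData_mem_iff (hcs : ∀ c ∈ cs, Candidate.compatible c c = true) :
    (instanceData cs bs, 4 * bs.length + 1) ∈ LengthColorPath ↔
      ∃ F : List ℕ → Candidate, ∀ A ∈ bs, F A ∈ cs ∧ (F A).block = A ∧
        ∀ B ∈ bs, Candidate.compatible (F A) (F B) = true := by
  classical
  have hG : encodeGraph (reductionGraph cs bs hcs) =
      enc ((vertices cs bs).map fun u => (vertices cs bs).map fun v => linked u v) := by
    change _ = Data.ofList _
    rw [encodeGraph, List.map_map, ← ofFn_eq_map]
    congr 2
    funext i
    change _ = Data.ofList _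
    rw [List.map_map, ← ofFn_eq_map]
    congr 2
    funext j
    change _ = Data.ofBool _
    congr 1
    rw [Bool.eq_iff_iff, decide_eq_true_iff]
    rfl
  have hc (f : Vertex → ℕ) (h1 h2) : encodeColoring (reductionColoring (bs := bs) hcs f h1 h2) =
      enc ((vertices cs bs).map fun u => f u) := by
    change _ = Data.ofList _
    rw [encodeColoring, List.map_map, ← ofFn_eq_map]
    rfl
  have hinst : instanceData cs bs = Data.node (encodeGraph (reductionGraph cs bs hcs))
      (Data.node (Data.ofNat (cs.length + 3)) (Data.node
        (encodeColoring (reductionColoring (bs := bs) hcs startColor (fun _ => startColor_mem)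
          fun _ hu _ hv => startColor_ne hcs hu hv))
        (encodeColoring (reductionColoring (bs := bs) hcs endColor (fun _ => endColor_mem)
          fun _ hu _ hv => endColor_ne hcs hu hv)))) := by
    rw [hG, hc, hc]
    rfl
  rw [hinst, mem_lengthColorPath_iff]
  constructor
  · rintro ⟨w, -⟩
    obtain ⟨s, hs, he⟩ := List.mem_iff_getElem.1 (mem_vertices.2
      (Or.inr (Or.inr (Or.inr rfl))) : ((3, [2, 1], ([], [], [])) : Vertex) ∈ vertices cs bs)
    refine reduction_sound hcs w (fun i hi => rfl) (s := ⟨s, hs⟩) he ?_ ?_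
    · change startColor (vertices cs bs)[s] = 2
      rw [he]; rfl
    · change endColor (vertices cs bs)[s] = 1
      rw [he]; rfl
  · rintro ⟨F, hF⟩
    exact reduction_complete hcs hF

end

/-! ### Decoding circuits -/

namespace Data

/-- Every tree encodes a list of trees. -/
def toList : Data → List Data
  | nil => []
  | node a l => a :: toList l

/-- The number that a tree encodes, if it encodes a number. -/
def toNat (x : Data) : ℕ := x.toList.length

theorem ofList_toList (x : Data) : ofList x.toList = x := by
  induction x with
  | nil => rfl
  | node a l _ ih => rw [toList, ofList, ih]

theorem toList_ofList (l : List Data) : (ofList l).toList = l := by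
  induction l with
  | nil => rfl
  | cons a l ih => rw [ofList, toList, ih]

theorem toNat_ofNat (n : ℕ) : (ofNat n).toNat = n := by
  induction n with
  | zero => rfl
  | succ n ih => exact congrArg (· + 1) ih

/-- The gate that a tree encodes, if it encodes a gate. -/
def toGate (x : Data) : Gate :=
  if x.fst = ofNat 0 then Gate.input x.snd.toNat
  else if x.fst = ofNat 1 then Gate.neg x.snd.toNat
  else if x.fst = ofNat 2 then Gate.conj (x.snd.toList.map toNat)
  else Gate.disj (x.snd.toList.map toNat)

theorem map_toNat_toList (l : List ℕ) : (ofList (l.map ofNat)).toList.map toNat = l := by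
  rw [toList_ofList, List.map_map]
  conv_rhs => rw [← List.map_id l]
  exact List.map_congr_left fun n _ => toNat_ofNat n

theorem toGate_encode (g : Gate) : g.encode.toGate = g := by
  cases g <;>
  simp [Gate.encode, toGate, fst, snd, Data.ofNat_injective.eq_iff, toNat_ofNat, map_toNat_toList]

end Data

instance : Enc Gate := ⟨Gate.encode, Function.LeftInverse.injective Data.toGate_encode⟩

/-! ### Polynomial time of the gate tests, the candidates and the graph -/

namespace PolyTime

section

variable {α : Type} [Enc α]

@[fun_prop]
theorem toList {x : α → Data} (hx : PolyTime x) : PolyTime fun a => (x a).toList :=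
  hx.of_enc_eq fun a => by
    change Data.ofList (List.map (fun y => y) _) = _
    rw [List.map_id', Data.ofList_toList]
    rfl

@[fun_prop]
theorem toNat {x : α → Data} (hx : PolyTime x) : PolyTime fun a => (x a).toNat := by
  unfold Data.toNat
  fun_prop

@[fun_prop]
theorem gateTag {g : α → Gate} (hg : PolyTime g) : PolyTime fun a => (g a).tag :=
  hg.encode.dataFst.of_enc_eq fun a => by cases g a <;> rfl

@[fun_prop]
theorem gateVar {g : α → Gate} (hg : PolyTime g) : PolyTime fun a => (g a).var := by
  have : PolyTime fun a => if (g a).tag = 0 then (enc (g a)).snd else Data.nil := by fun_prop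
  exact this.of_enc_eq fun a => by cases g a <;> rfl

@[fun_prop]
theorem gatePreds {g : α → Gate} (hg : PolyTime g) : PolyTime fun a => (g a).preds := by
  have : PolyTime fun a => if (g a).tag = 0 then Data.nil
      else if (g a).tag = 1 then Data.node (enc (g a)).snd Data.nil else (enc (g a)).snd := by
    fun_prop
  exact this.of_enc_eq fun a => by cases g a <;> rfl

@[fun_prop]
theorem toGate {x : α → Data} (hx : PolyTime x) : PolyTime fun a => (x a).toGate := by
  have : PolyTime fun a =>
      if (x a).fst = Data.ofNat 0 then Data.node (Data.ofNat 0) (enc (x a).snd.toNat)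
      else if (x a).fst = Data.ofNat 1 then Data.node (Data.ofNat 1) (enc (x a).snd.toNat)
      else if (x a).fst = Data.ofNat 2 then
        Data.node (Data.ofNat 2) (enc ((x a).snd.toList.map fun y => y.toNat))
      else Data.node (Data.ofNat 3) (enc ((x a).snd.toList.map fun y => y.toNat)) := by
    fun_prop
  refine this.of_enc_eq fun a => ?_
  unfold Data.toGate
  split_ifs <;> rfl

@[fun_prop]
theorem gateIsLarge {g : α → Gate} (hg : PolyTime g) : PolyTime fun a => (g a).isLarge := by
  unfold Gate.isLarge
  fun_prop

@[fun_prop]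
theorem gatePolarity {g : α → Gate} (hg : PolyTime g) : PolyTime fun a => (g a).polarity := by
  unfold Gate.polarity
  fun_prop

@[fun_prop]
theorem gateAt {gs : α → List Gate} {j : α → ℕ} (hgs : PolyTime gs) (hj : PolyTime j) :
    PolyTime fun a => gateAt (gs a) (j a) := by
  unfold _root_.gateAt
  fun_prop

end

@[fun_prop]
-- The depth `f` is a constant, so the recursion unfolds into finitely many list traversals. The
-- domain is quantified inside the induction, because each traversal adds the current list element
-- to it.
theorem shallow (f : ℕ) : ∀ {α : Type} [Enc α] {gs : α → List Gate} {b : α → Bool} {j : α → ℕ}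
    (_ : PolyTime gs) (_ : PolyTime b) (_ : PolyTime j),
    PolyTime fun a => shallow (gs a) f (b a) (j a) := by
  induction f with
  | zero => intros; simp only [_root_.shallow]; fun_prop
  | succ f ih => intros; simp only [_root_.shallow]; fun_prop

section

variable {α : Type} [Enc α]

@[fun_prop]
theorem windowForces {w : α → List (ℕ × ℕ)} {i : α → ℕ} {b : α → Bool} (hw : PolyTime w)
    (hi : PolyTime i) (hb : PolyTime b) : PolyTime fun a => windowForces (w a) (i a) (b a) := by
  unfold _root_.windowForces
  fun_prop

@[fun_prop]
theorem assumable (d : ℕ) {gs : α → List Gate} {j : α → ℕ} (hgs : PolyTime gs)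
    (hj : PolyTime j) : PolyTime fun a => assumable (gs a) d (j a) := by
  unfold _root_.assumable
  fun_prop

end

@[fun_prop]
theorem forces (d f : ℕ) : ∀ {α : Type} [Enc α] {gs : α → List Gate} {w : α → List (ℕ × ℕ)}
    {g : α → List ℕ} {j : α → ℕ} {b : α → Bool} (_ : PolyTime gs) (_ : PolyTime w)
    (_ : PolyTime g) (_ : PolyTime j) (_ : PolyTime b),
    PolyTime fun a => forces (gs a) d (w a) (g a) f (j a) (b a) := by
  induction f with
  | zero => intros; simp only [_root_.forces]; fun_prop
  | succ f ih => intros; simp only [_root_.forces]; fun_prop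

@[fun_prop]
theorem listsLE (m : ℕ) : ∀ {α β : Type} [Enc α] [Enc β] {l : α → List β} (_ : PolyTime l),
    PolyTime fun a => listsLE (l a) m := by
  induction m with
  | zero => intros; simp only [_root_.listsLE]; fun_prop
  | succ m ih => intros; simp only [_root_.listsLE]; fun_prop

section

variable {α : Type} [Enc α]

@[fun_prop]
theorem refutes (d : ℕ) {gs : α → List Gate} {w : α → List (ℕ × ℕ)} {j : α → ℕ}
    (hgs : PolyTime gs) (hw : PolyTime w) (hj : PolyTime j) :
    PolyTime fun a => refutes (gs a) d (w a) (j a) := by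
  unfold _root_.refutes
  fun_prop

@[fun_prop]
theorem consistent {w w' : α → List (ℕ × ℕ)} (hw : PolyTime w) (hw' : PolyTime w') :
    PolyTime fun a => consistent (w a) (w' a) := by
  unfold _root_.consistent
  fun_prop

@[fun_prop]
theorem candidateBlock {c : α → Candidate} (hc : PolyTime c) :
    PolyTime fun a => Candidate.block (c a) := by
  unfold Candidate.block
  fun_prop

@[fun_prop]
theorem candidateCompatible {c c' : α → Candidate} (hc : PolyTime c) (hc' : PolyTime c') :
    PolyTime fun a => Candidate.compatible (c a) (c' a) := by
  unfold Candidate.compatible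
  fun_prop

@[fun_prop]
theorem candidateValid (d : ℕ) {gs : α → List Gate} {n k : α → ℕ} {c : α → Candidate}
    (hgs : PolyTime gs) (hn : PolyTime n) (hk : PolyTime k) (hc : PolyTime c) :
    PolyTime fun a => Candidate.valid (gs a) d (n a) (k a) (c a) := by
  unfold Candidate.valid
  fun_prop

@[fun_prop]
theorem blocks (d : ℕ) {k : α → ℕ} (hk : PolyTime k) : PolyTime fun a => blocks d (k a) := by
  unfold _root_.blocks
  fun_prop

@[fun_prop]
theorem candidates (d : ℕ) {gs : α → List Gate} {n k : α → ℕ}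
    (hgs : PolyTime gs) (hn : PolyTime n) (hk : PolyTime k) :
    PolyTime fun a => candidates (gs a) d (n a) (k a) := by
  unfold _root_.candidates
  fun_prop

@[fun_prop]
theorem linkedTo {u v : α → Vertex} (hu : PolyTime u) (hv : PolyTime v) :
    PolyTime fun a => linkedTo (u a) (v a) := by
  unfold _root_.linkedTo
  fun_prop

@[fun_prop]
theorem linked {u v : α → Vertex} (hu : PolyTime u) (hv : PolyTime v) :
    PolyTime fun a => linked (u a) (v a) := by
  unfold _root_.linked
  fun_prop

@[fun_prop]
theorem candAt {cs : α → List Candidate} {c : α → ℕ} (hcs : PolyTime cs) (hc : PolyTime c) :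
    PolyTime fun a => candAt (cs a) (c a) := by
  unfold _root_.candAt
  fun_prop

@[fun_prop]
theorem selectorColors {cs : α → List Candidate} {A : α → List ℕ} (hcs : PolyTime cs)
    (hA : PolyTime A) : PolyTime fun a => selectorColors (cs a) (A a) := by
  unfold _root_.selectorColors
  fun_prop

@[fun_prop]
theorem vertices {cs : α → List Candidate} {bs : α → List (List ℕ)} (hcs : PolyTime cs)
    (hbs : PolyTime bs) : PolyTime fun a => vertices (cs a) (bs a) := by
  unfold _root_.vertices
  fun_prop

@[fun_prop]
theorem startColor {u : α → Vertex} (hu : PolyTime u) : PolyTime fun a => startColor (u a) := by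
  unfold _root_.startColor
  fun_prop

@[fun_prop]
theorem endColor {u : α → Vertex} (hu : PolyTime u) : PolyTime fun a => endColor (u a) := by
  unfold _root_.endColor
  fun_prop

@[fun_prop]
theorem instanceData {cs : α → List Candidate} {bs : α → List (List ℕ)} (hcs : PolyTime cs)
    (hbs : PolyTime bs) : PolyTime fun a => instanceData (cs a) (bs a) := by
  unfold _root_.instanceData
  fun_prop

end

end PolyTime

/-! ### The reduction -/

/-- The circuit that a tree encodes, if it encodes a circuit. -/
def Data.toCircuit (x : Data) : Circuit := ⟨x.fst.toNat, x.snd.toList.map fun y => y.toGate⟩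

theorem Data.toCircuit_encode (C : Circuit) : C.encode.toCircuit = C := by
  obtain ⟨n, gs⟩ := C
  simp only [toCircuit, Circuit.encode, fst, snd, toNat_ofNat, toList_ofList, List.map_map]
  congr 1
  conv_rhs => rw [← List.map_id gs]
  exact List.map_congr_left fun g _ => toGate_encode g

/-- Tests that a circuit is well-formed. -/
def wellFormedTest (n : ℕ) (gs : List Gate) : Bool :=
  decide (0 < gs.length) && (List.range gs.length).all fun j =>
    (gateAt gs j).preds.all (fun c => decide (c < j)) &&
      (!decide ((gateAt gs j).tag = 0) || decide ((gateAt gs j).var < n))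

theorem Circuit.wellFormed_iff (C : Circuit) :
    C.WellFormed ↔ wellFormedTest C.numInputs C.gates = true := by
  simp only [Circuit.WellFormed, wellFormedTest, Bool.and_eq_true, decide_eq_true_eq,
    List.length_pos_iff, List.all_eq_true, List.mem_range]
  refine and_congr_right fun _ => forall₂_congr fun i hi => ?_
  rw [gateAt_eq hi]
  refine and_congr_right fun _ => ?_
  generalize C.gates[i] = g
  cases g with
  | input v =>
    simp only [Gate.tag, Gate.var, Gate.input.injEq, forall_eq', decide_true, Bool.not_true,
      Bool.false_or]
    exact decide_eq_true_iff.symm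
  | _ => simp [Gate.tag]

/-- Tests that a tree encodes a well-formed circuit of weft at most one and depth at most `d`. -/
def circuitTest (d : ℕ) (x : Data) : Bool :=
  decide (x.toCircuit.encode = x) &&
    (wellFormedTest x.toCircuit.numInputs x.toCircuit.gates &&
      shallow x.toCircuit.gates d true x.toCircuit.gates.tail.length)

theorem circuitTest_iff (d : ℕ) (x : Data) : circuitTest d x = true ↔
    ∃ C : Circuit, C.WellFormed ∧ C.weft ≤ 1 ∧ C.depth ≤ d ∧ x = C.encode := by
  rw [circuitTest, Bool.and_eq_true, Bool.and_eq_true, decide_eq_true_eq, ← Circuit.wellFormed_iff]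
  constructor
  · rintro ⟨h1, h2, h3⟩
    rw [List.length_tail, h2.shallow_output_iff] at h3
    exact ⟨_, h2, h3.2, h3.1, h1.symm⟩
  · rintro ⟨C, h1, h2, h3, rfl⟩
    rw [Data.toCircuit_encode, List.length_tail, h1.shallow_output_iff]
    exact ⟨rfl, h1, h3, h2⟩

/-- The reduction from weighted satisfiability of circuits of weft one to recoloring. -/
def recoloringInstance (d : ℕ) (p : Data × ℕ) : Data × ℕ :=
  if circuitTest d p.1 = true then
    (instanceData (candidates p.1.toCircuit.gates d p.1.toCircuit.numInputs p.2) (blocks d p.2),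
      -- Four copies of the list of blocks give the number of steps without a multiplication.
      (blocks d p.2 ++ (blocks d p.2 ++ (blocks d p.2 ++ blocks d p.2))).length + 1)
  else (Data.nil, 0)

theorem recoloringInstance_mem_iff (d : ℕ) (p : Data × ℕ) :
    p ∈ WeightedCircuitSat 1 d ↔ recoloringInstance d p ∈ LengthColorPath := by
  by_cases h : circuitTest d p.1 = true
  · rw [recoloringInstance, if_pos h]
    have hlen : (blocks d p.2 ++ (blocks d p.2 ++ (blocks d p.2 ++ blocks d p.2))).length + 1 =
        4 * (blocks d p.2).length + 1 := by
      simp only [List.length_append]; ring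
    obtain ⟨C, h1, h2, h3, h4⟩ := (circuitTest_iff d p.1).1 h
    have hC : p.1.toCircuit = C := by rw [h4, Data.toCircuit_encode]
    rw [hlen, hC, instanceData_mem_iff (cs := candidates C.gates d C.numInputs p.2) fun c hc =>
      Candidate.compatible_self (List.mem_filter.1 hc).2,
      ← h1.exists_candidates_iff p.2 ((h1.shallow_output_iff d).2 ⟨h3, h2⟩)]
    constructor
    · rintro ⟨C', -, -, -, h5, hS⟩
      have : C' = C := by rw [← hC, h5, Data.toCircuit_encode]
      rwa [this] at hS
    · exact fun hS => ⟨C, h1, h2, h3, h4, hS⟩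
  · rw [recoloringInstance, if_neg h]
    constructor
    · rintro ⟨C, h1, h2, h3, h4, -⟩
      exact absurd ((circuitTest_iff d p.1).2 ⟨C, h1, h2, h3, h4⟩) h
    -- The default instance is the empty tree, which encodes no instance because encoded instances
    -- are nodes.
    · rintro ⟨n, k, G, α, β, he, -⟩
      exact absurd he (by simp)

theorem length_blocks_le (d k : ℕ) : (blocks d k).length ≤ (k + 3) ^ 2 ^ (d + 1) := by
  have := length_listsLE_le (List.range (k + 2)) (2 ^ (d + 1))
  rwa [List.length_range] at this

theorem recoloringInstance_snd_le (d : ℕ) (p : Data × ℕ) :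
    (recoloringInstance d p).2 ≤ 4 * (p.2 + 3) ^ 2 ^ (d + 1) + 1 := by
  have := length_blocks_le d p.2
  unfold recoloringInstance
  split_ifs
  · simp only [List.length_append]; omega
  · exact Nat.zero_le _

/-! ### Polynomial time of the whole reduction -/

namespace PolyTime

variable {α : Type} [Enc α]

@[fun_prop]
theorem numInputs {x : α → Data} (hx : PolyTime x) :
    PolyTime fun a => (x a).toCircuit.numInputs := by
  unfold Data.toCircuit
  fun_prop

@[fun_prop]
theorem gates {x : α → Data} (hx : PolyTime x) : PolyTime fun a => (x a).toCircuit.gates := by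
  unfold Data.toCircuit
  fun_prop

@[fun_prop]
theorem encodeCircuit {x : α → Data} (hx : PolyTime x) :
    PolyTime fun a => (x a).toCircuit.encode := by
  have : PolyTime fun a => ((x a).toCircuit.numInputs, (x a).toCircuit.gates) := by fun_prop
  exact this.of_enc_eq fun _ => rfl

@[fun_prop]
theorem wellFormedTest {n : α → ℕ} {gs : α → List Gate} (hn : PolyTime n) (hgs : PolyTime gs) :
    PolyTime fun a => wellFormedTest (n a) (gs a) := by
  unfold _root_.wellFormedTest
  fun_prop

@[fun_prop]
theorem circuitTest (d : ℕ) {x : α → Data} (hx : PolyTime x) :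
    PolyTime fun a => circuitTest d (x a) := by
  unfold _root_.circuitTest
  fun_prop

theorem recoloringInstance (d : ℕ) : PolyTime (recoloringInstance d) := by
  unfold _root_.recoloringInstance
  fun_prop

end PolyTime

/-! ### Computable bounds and composition of reductions -/

theorem Computable.pow_const {f : ℕ → ℕ} (hf : Computable f) (c : ℕ) :
    Computable fun k => f k ^ c := by
  induction c with
  | zero => simpa using Computable.const 1
  | succ c ih =>
    simp only [pow_succ]
    exact Primrec.nat_mul.to_comp.comp ih hf

theorem Computable.nat_add_const {f : ℕ → ℕ} (hf : Computable f) (c : ℕ) :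
    Computable fun k => f k + c :=
  Primrec.nat_add.to_comp.comp hf (Computable.const c)

theorem Computable.nat_const_mul {f : ℕ → ℕ} (hf : Computable f) (c : ℕ) :
    Computable fun k => c * f k :=
  Primrec.nat_mul.to_comp.comp (Computable.const c) hf

/-- An fpt-reduction may be followed by a reduction in polynomial time. -/
theorem FptReduces.comp_polyTime {Q P P' : ParamProblem} (h : FptReduces Q P)
    {F : Data × ℕ → Data × ℕ} (hF : PolyTime F) {b : ℕ → ℕ} (hb : Computable b)
    (hmono : Monotone b) (hFb : ∀ p, (F p).2 ≤ b p.2) (hiff : ∀ p, p ∈ P ↔ F p ∈ P') :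
    FptReduces Q P' := by
  obtain ⟨R, f, g, c, hf, hg, hR⟩ := h
  obtain ⟨p, e, hp⟩ := hF
  -- The first run, the second run and the overhead of `seq` are each at most `(s + 2) ^ (e + 1)`,
  -- hence the factor `3`; and `s + 2 ≤ (f k + 2) * x.size ^ c`, since a tree has at least one node.
  refine ⟨R.seq p, fun k => 3 * (f k + 2) ^ (e + 1), fun k => b (g k), c * (e + 1),
    ((hf.nat_add_const 2).pow_const _).nat_const_mul 3, hb.comp hg, fun x k => ?_⟩
  obtain ⟨y, m, s, hs, hsle, hm, hxy⟩ := hR x k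
  obtain ⟨t, ht, htle⟩ := hp (y, m)
  refine ⟨(F (y, m)).1, (F (y, m)).2, _, hs.seq ht, ?_, (hFb _).trans (hmono hm),
    hxy.trans (hiff _)⟩
  have h1 : esize (y, m) ≤ s := hs.size_le.1
  have h2 := hs.size_le.2
  have hx : 1 ≤ x.size ^ c := Nat.one_le_pow _ _ x.one_le_size
  have h3 : s + 2 ≤ (f k + 2) * x.size ^ c := by
    rw [add_mul]; omega
  have h4 : t ≤ (s + 2) ^ e := htle.trans (Nat.pow_le_pow_left (by omega) e)
  have h5 : (s + 2) ^ (e + 1) ≤ (f k + 2) ^ (e + 1) * x.size ^ (c * (e + 1)) := by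
    rw [pow_mul, ← mul_pow]
    exact Nat.pow_le_pow_left h3 _
  have h6 : (s + 2) ^ e ≤ (s + 2) ^ (e + 1) := Nat.pow_le_pow_right (by omega) (by omega)
  have h7 : s + 2 ≤ (s + 2) ^ (e + 1) := Nat.le_self_pow (by omega) _
  rw [mul_assoc]
  omega

theorem mainTheorem1 : WHard 1 LengthColorPath := by
  rintro Q ⟨d, hQ⟩
  refine hQ.comp_polyTime (PolyTime.recoloringInstance d)
    (b := fun k => 4 * (k + 3) ^ 2 ^ (d + 1) + 1)
    ((((Computable.id.nat_add_const 3).pow_const _).nat_const_mul 4).nat_add_const 1)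
    (fun k l hkl => ?_) (recoloringInstance_snd_le d) (recoloringInstance_mem_iff d)
  have := Nat.pow_le_pow_left (Nat.add_le_add_right hkl 3) (2 ^ (d + 1))
  dsimp only
  omega
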